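/- Let $m\ge 0$ and let $\pi:E\to M$ be a particle bundle of mass $m$: a smooth Hermitian complex vector bundle of finite positive rank over $M=\{\mathbf k\in\mathbb R^3 : m^2+|\mathbf k|^2>0\}$ (so $M=\mathbb R^3$ if $m>0$ and $M=\mathbb R^3\setminus\{0\}$ if $m=0$) with a smooth, unitary, irreducible action $\Sigma$ of the proper orthochronous Poincaré group by bundle isomorphisms covering the standard action on the momenta $(\omega,\mathbf k)$, $\omega=\sqrt{m^2+|\mathbf k|^2}$, translations by $a$ acting on the fibre over $\mathbf k$ as $e^{i(\omega a^0-\mathbf k\cdot\mathbf a)}$. On smooth sections put $(\tilde\Sigma_g\psi)(\mathbf k)=\Sigma_g[\psi(g^{-1}\mathbf k)]$ and $J_a\psi=i\frac{d}{dt}\big|_{t=0}\tilde\Sigma_{R_a(t)}\psi$, where $R_a(t)$ is the rotation by the angle $t$ about the $a$-th coordinate axis. Let $D$ be a smooth complex-linear connection on $E$, with curvature $F_D(X,Y)=D_XD_Y-D_YD_X-D_{[X,Y]}$, and let $\mathbf L^D=-i\,\mathbf k\times D$ and $\mathbf S^D=\mathbf J-\mathbf L^D$, that is, $L^D_a=-iD_{\mathbf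 e_a\times\mathbf k}$ and $S^D_a=J_a-L^D_a$. Call $D$ $S^2$-flat if $F_D(X,Y)=0$ for all smooth vector fields $X,Y$ on $M$ with $X(\mathbf k)\cdot\mathbf k=Y(\mathbf k)\cdot\mathbf k=0$ for all $\mathbf k$, and rotationally symmetric if $D_{RX}=\tilde\Sigma_RD_X\tilde\Sigma_{R^{-1}}$ for all $R\in\mathrm{SO}(3)$ and all smooth vector fields $X$, where $(RX)(\mathbf k)=R\,X(R^{-1}\mathbf k)$. Then, as operators on smooth sections: 1. for every connection $D$, $[L^D_a,L^D_b]=i\epsilon_{abc}L^D_c-F_D(\mathbf e_a\times\mathbf k,\mathbf e_b\times\mathbf k)$, and the relations $[L^D_a,L^D_b]=i\epsilon_{abc}L^D_c$ hold for all $a,b$ if and only if $D$ is $S^2$-flat; 2. if $D$ is rotationally symmetric, then $\mathbf S^D$ and $\mathbf L^D$ both satisfy the angular momentum relations $[S^D_a,S^D_b]=i\epsilon_{abc}S^D_c$ and $[L^D_a,L^D_b]=i\epsilon_{abc}L^D_c$ if and only if $D$ is $S^2$-flat; moreover the relations for $\mathbf S^D$ alone are also equivalent to $S^2$-flatness. 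-/

import Mathlib

open Bundle Matrix
open scoped Manifold ContDiff InnerProductSpace

namespace Particle

noncomputable section

/-! ### Minkowski space and the Poincaré group -/

/-- Euclidean three-space (used both for positions and for momenta `𝐤`). -/
abbrev E3 : Type := EuclideanSpace ℝ (Fin 3)

/-- Minkowski space: pairs (time component, space component). -/
abbrev Mink : Type := ℝ × E3

/-- The Minkowski bilinear form `p⁰ q⁰ - 𝐩 ⬝ 𝐪`. -/
def minkForm (p q : Mink) : ℝ := p.1 * q.1 - inner ℝ p.2 q.2

/-- Nonzero future-directed causal vectors. -/
def FutureCausal (p : Mink) : Prop := 0 < p.1 ∧ ‖p.2‖ ≤ p.1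

/-- The proper orthochronous Lorentz group `SO⁺(3,1)`: linear automorphisms of Minkowski space
that preserve the Minkowski form, have determinant one and preserve the direction of time. -/
def restrictedLorentz : Subgroup (Mink ≃ₗ[ℝ] Mink) where
  carrier := {Λ | (∀ p q, minkForm (Λ p) (Λ q) = minkForm p q) ∧
    LinearMap.det (Λ : Mink →ₗ[ℝ] Mink) = 1 ∧ ∀ p, FutureCausal (Λ p) ↔ FutureCausal p}
  mul_mem' := by
    rintro Λ₁ Λ₂ ⟨h1, h2, h3⟩ ⟨k1, k2, k3⟩
    refine ⟨fun p q => (h1 _ _).trans (k1 _ _), ?_, fun p => (h3 _).trans (k3 _)⟩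
    have : ((Λ₁ * Λ₂ : Mink ≃ₗ[ℝ] Mink) : Mink →ₗ[ℝ] Mink)
        = (Λ₁ : Mink →ₗ[ℝ] Mink) ∘ₗ (Λ₂ : Mink →ₗ[ℝ] Mink) := rfl
    rw [this, LinearMap.det_comp, h2, k2, one_mul]
  one_mem' := by
    refine ⟨fun p q => rfl, ?_, fun p => Iff.rfl⟩
    have : ((1 : Mink ≃ₗ[ℝ] Mink) : Mink →ₗ[ℝ] Mink) = LinearMap.id := rfl
    rw [this, LinearMap.det_id]
  inv_mem' := by
    rintro Λ ⟨h1, h2, h3⟩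
    have key : ∀ p, Λ (Λ⁻¹ p) = p := fun p => Λ.apply_symm_apply p
    refine ⟨fun p q => ?_, ?_, fun p => ?_⟩
    · rw [← h1, key, key]
    · have h : (Λ : Mink →ₗ[ℝ] Mink) ∘ₗ ((Λ⁻¹ : Mink ≃ₗ[ℝ] Mink) : Mink →ₗ[ℝ] Mink)
          = LinearMap.id := LinearMap.ext key
      have h' := congrArg LinearMap.det h
      rw [LinearMap.det_comp, h2, LinearMap.det_id, one_mul] at h'
      exact h'
    · rw [← h3, key]

/-- The proper orthochronous Poincaré group `ISO⁺(3,1)`: affine automorphisms of Minkowski space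
whose linear part is a proper orthochronous Lorentz transformation. -/
def Poincare : Subgroup (Mink ≃ᵃ[ℝ] Mink) := restrictedLorentz.comap AffineEquiv.linearHom

/-- The coordinates `(Λ, a)` of the Poincaré transformation `x ↦ Λ x + a`; they embed the group as
a closed submanifold of a finite-dimensional vector space. -/
def poincareCoords (g : Poincare) : (Mink →L[ℝ] Mink) × Mink :=
  (LinearMap.toContinuousLinearMap (g.1.linear : Mink →ₗ[ℝ] Mink), g.1 0)

/-- The translation of spacetime by `a`. -/
def translation (a : Mink) : Poincare :=
  ⟨AffineEquiv.constVAdd ℝ Mink a, restrictedLorentz.one_mem⟩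

/-! ### Rotations -/

/-- The rotation group `SO(3)`. -/
abbrev SO3 : Type := Matrix.specialOrthogonalGroup (Fin 3) ℝ

/-- The action of a rotation on vectors. -/
def SO3.act (R : SO3) (v : E3) : E3 := WithLp.toLp 2 (R.1 *ᵥ v.ofLp)

lemma SO3.transpose_mul (R : SO3) : R.1ᵀ * R.1 = 1 := by
  have h := (Matrix.mem_specialOrthogonalGroup_iff.1 R.2).1
  rw [Matrix.mem_orthogonalGroup_iff'] at h
  simpa [Matrix.star_eq_conjTranspose] using h

lemma SO3.mul_transpose (R : SO3) : R.1 * R.1ᵀ = 1 :=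
  mul_eq_one_comm.1 R.transpose_mul

lemma SO3.inner_act (R : SO3) (v w : E3) : inner ℝ (R.act v) (R.act w) = inner ℝ v w := by
  simp only [SO3.act, EuclideanSpace.inner_eq_star_dotProduct, star_trivial]
  rw [Matrix.dotProduct_mulVec, Matrix.vecMul_mulVec, R.transpose_mul, Matrix.vecMul_one]

/-- A rotation as a linear automorphism of Minkowski space that fixes the time axis. -/
def SO3.toLorentz (R : SO3) : Mink ≃ₗ[ℝ] Mink where
  toFun p := (p.1, R.act p.2)
  map_add' p q := by
    ext i <;> simp [SO3.act, Matrix.mulVec_add]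
  map_smul' c p := by
    ext i <;> simp [SO3.act, Matrix.mulVec_smul]
  invFun p := (p.1, WithLp.toLp 2 (R.1ᵀ *ᵥ p.2.ofLp))
  left_inv p := by
    simp [SO3.act, Matrix.mulVec_mulVec, R.transpose_mul]
  right_inv p := by
    simp [SO3.act, Matrix.mulVec_mulVec, R.mul_transpose]

lemma SO3.toLorentz_mem (R : SO3) : R.toLorentz ∈ restrictedLorentz := by
  refine ⟨fun p q => ?_, ?_, fun p => ?_⟩
  · simp [minkForm, SO3.toLorentz, R.inner_act]
  · have h : (R.toLorentz : Mink →ₗ[ℝ] Mink)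
        = LinearMap.prodMap LinearMap.id (Matrix.toEuclideanLin R.1) := rfl
    rw [h, LinearMap.det_prodMap, LinearMap.det_id, one_mul]
    rw [Matrix.toEuclideanLin, Matrix.toLpLin_eq_toLin, LinearMap.det_toLin]
    exact (Matrix.mem_specialOrthogonalGroup_iff.1 R.2).2
  · have hn : ‖R.act p.2‖ = ‖p.2‖ := by
      rw [@norm_eq_sqrt_real_inner E3, @norm_eq_sqrt_real_inner E3, R.inner_act]
    show 0 < p.1 ∧ ‖R.act p.2‖ ≤ p.1 ↔ _
    rw [hn]
    rfl

/-- The inclusion of `SO(3)` into the Poincaré group. -/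
def SO3.toPoincare (R : SO3) : Poincare :=
  ⟨R.toLorentz.toAffineEquiv, R.toLorentz_mem⟩

/-- The `a`-th vector of the standard basis of `ℝ³`. -/
def e (a : Fin 3) : E3 := EuclideanSpace.single a 1

/-- The cross product on `ℝ³`. -/
def cross (v w : E3) : E3 := WithLp.toLp 2 (v.ofLp ⨯₃ w.ofLp)

/-- The Levi-Civita symbol `ε_abc = (e_a × e_b) ⬝ e_c`. -/
def eps (a b c : Fin 3) : ℝ := cross (e a) (e b) c

/-- The matrix of the rotation by the angle `t` about the `a`-th coordinate axis (right-handed). -/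
def rotMatrix (a : Fin 3) (t : ℝ) : Matrix (Fin 3) (Fin 3) ℝ :=
  match a with
  | 0 => !![1, 0, 0; 0, Real.cos t, -Real.sin t; 0, Real.sin t, Real.cos t]
  | 1 => !![Real.cos t, 0, Real.sin t; 0, 1, 0; -Real.sin t, 0, Real.cos t]
  | 2 => !![Real.cos t, -Real.sin t, 0; Real.sin t, Real.cos t, 0; 0, 0, 1]

lemma rotMatrix_mem (a : Fin 3) (t : ℝ) :
    rotMatrix a t ∈ Matrix.specialOrthogonalGroup (Fin 3) ℝ := by
  have hs := Real.sin_sq_add_cos_sq t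
  rw [Matrix.mem_specialOrthogonalGroup_iff, Matrix.mem_orthogonalGroup_iff]
  constructor
  · fin_cases a <;> ext i j <;> fin_cases i <;> fin_cases j <;>
      simp [rotMatrix, Matrix.mul_apply, Fin.sum_univ_three] <;> nlinarith
  · fin_cases a <;> simp [rotMatrix, Matrix.det_fin_three] <;> nlinarith

/-- The rotation `R_a(t)` by the angle `t` about the `a`-th coordinate axis. -/
def rot (a : Fin 3) (t : ℝ) : SO3 := ⟨rotMatrix a t, rotMatrix_mem a t⟩

/-! ### Momentum space -/

/-- The momenta `𝐤` of a particle of mass `m`: all of `ℝ³` for `m > 0` (the mass hyperboloid) and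
`ℝ³ \ {0}` for `m = 0` (the forward light cone without its apex). -/
def momentumSpace (m : ℝ) : TopologicalSpace.Opens E3 where
  carrier := {k | 0 < m ^ 2 + ‖k‖ ^ 2}
  is_open' := isOpen_lt continuous_const (by fun_prop)

/-- The energy `ω(𝐤) = √(m² + |𝐤|²)`. -/
def energy (m : ℝ) (k : E3) : ℝ := Real.sqrt (m ^ 2 + ‖k‖ ^ 2)

/-- The four-momentum `(ω(𝐤), 𝐤)`. -/
def fourMomentum {m : ℝ} (k : momentumSpace m) : Mink := (energy m k, k)

lemma fourMomentum_sq {m : ℝ} (k : momentumSpace m) :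
    minkForm (fourMomentum k) (fourMomentum k) = m ^ 2 := by
  have hk : 0 < m ^ 2 + ‖(k : E3)‖ ^ 2 := k.2
  simp only [minkForm, fourMomentum, energy, real_inner_self_eq_norm_sq]
  rw [Real.mul_self_sqrt hk.le]
  ring

lemma fourMomentum_future {m : ℝ} (k : momentumSpace m) : FutureCausal (fourMomentum k) := by
  have hk : 0 < m ^ 2 + ‖(k : E3)‖ ^ 2 := k.2
  refine ⟨Real.sqrt_pos.2 hk, ?_⟩
  show ‖(k : E3)‖ ≤ Real.sqrt (m ^ 2 + ‖(k : E3)‖ ^ 2)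
  exact Real.le_sqrt_of_sq_le (by nlinarith [sq_nonneg m])

lemma lorentz_sq {m : ℝ} {Λ : Mink ≃ₗ[ℝ] Mink} (hΛ : Λ ∈ restrictedLorentz)
    (k : momentumSpace m) :
    0 < (Λ (fourMomentum k)).1 ∧
      (Λ (fourMomentum k)).1 ^ 2 = m ^ 2 + ‖(Λ (fourMomentum k)).2‖ ^ 2 := by
  refine ⟨((hΛ.2.2 _).2 (fourMomentum_future k)).1, ?_⟩
  have h := (hΛ.1 (fourMomentum k) (fourMomentum k)).trans (fourMomentum_sq k)
  rw [minkForm, real_inner_self_eq_norm_sq] at h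
  linarith

lemma lorentz_mem {m : ℝ} {Λ : Mink ≃ₗ[ℝ] Mink} (hΛ : Λ ∈ restrictedLorentz)
    (k : momentumSpace m) : (Λ (fourMomentum k)).2 ∈ momentumSpace m := by
  obtain ⟨h1, h2⟩ := lorentz_sq hΛ k
  show 0 < m ^ 2 + ‖(Λ (fourMomentum k)).2‖ ^ 2
  rw [← h2]
  positivity

lemma fourMomentum_lorentz {m : ℝ} {Λ : Mink ≃ₗ[ℝ] Mink} (hΛ : Λ ∈ restrictedLorentz)
    (k : momentumSpace m) :
    fourMomentum (⟨(Λ (fourMomentum k)).2, lorentz_mem hΛ k⟩ : momentumSpace m)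
      = Λ (fourMomentum k) := by
  obtain ⟨h1, h2⟩ := lorentz_sq hΛ k
  refine Prod.ext ?_ rfl
  show Real.sqrt (m ^ 2 + ‖(Λ (fourMomentum k)).2‖ ^ 2) = _
  rw [← h2, Real.sqrt_sq h1.le]

/-- The action of the Poincaré group on momenta: the Lorentz transformation is applied to the
four-momentum; translations act trivially. -/
instance momentumAction (m : ℝ) : MulAction Poincare (momentumSpace m) where
  smul g k := ⟨(g.1.linear (fourMomentum k)).2, lorentz_mem g.2 k⟩
  one_smul k := rfl
  mul_smul g h k := by
    apply Subtype.ext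
    show (g.1.linear (h.1.linear (fourMomentum k))).2 = (g.1.linear (fourMomentum _)).2
    exact congrArg (fun p => (g.1.linear p).2) (fourMomentum_lorentz h.2 k).symm

/-! ### Particle bundles -/

section Bundles

variable {m : ℝ} (F : Type*) [NormedAddCommGroup F] [NormedSpace ℂ F]
  (V : momentumSpace m → Type*) [∀ k, NormedAddCommGroup (V k)]
  [∀ k, InnerProductSpace ℂ (V k)] [TopologicalSpace (TotalSpace F V)] [FiberBundle F V]
  [VectorBundle ℂ F V] [VectorBundle ℝ F V] [ContMDiffVectorBundle ∞ F V 𝓘(ℝ, E3)]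

/-- Smooth sections (wave functions) of the bundle. -/
def IsSmoothSection (ψ : ∀ k, V k) : Prop :=
  ContMDiff 𝓘(ℝ, E3) (𝓘(ℝ, E3).prod 𝓘(ℝ, F)) ∞ fun k => (⟨k, ψ k⟩ : TotalSpace F V)

/-- The structure of a (bosonic) particle bundle of mass `m` on a smooth complex vector bundle over
momentum space with an inner product on each fibre: the inner product varies smoothly, and the
Poincaré group acts smoothly, unitarily and irreducibly on the bundle, covering its standard
action on momenta, the translations acting on the fibre over the four-momentum `k` by the
character `exp (i k ⬝ a)`. -/
structure ParticleBundle where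
  /-- The fibre map `Σ_g : E(𝐤) → E(g 𝐤)`. -/
  act : ∀ (g : Poincare) (k : momentumSpace m), V k →ₗ[ℂ] V (g • k)
  act_one : ∀ (k : momentumSpace m) (v : V k),
    (⟨(1 : Poincare) • k, act 1 k v⟩ : TotalSpace F V) = ⟨k, v⟩
  act_mul : ∀ (g h : Poincare) (k : momentumSpace m) (v : V k),
    (⟨(g * h) • k, act (g * h) k v⟩ : TotalSpace F V) = ⟨g • h • k, act g (h • k) (act h k v)⟩
  /-- The action `(g, v) ↦ Σ_g v` is smooth on `ISO⁺(3,1) × E`, the group being regarded as a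
  submanifold of a vector space; the values of `Φ` off this submanifold are irrelevant. -/
  smooth_act : ∃ Φ : ((Mink →L[ℝ] Mink) × Mink) × TotalSpace F V → TotalSpace F V,
    (∀ (g : Poincare) (k : momentumSpace m) (v : V k),
      Φ (poincareCoords g, ⟨k, v⟩) = ⟨g • k, act g k v⟩) ∧
    ContMDiffOn (𝓘(ℝ, (Mink →L[ℝ] Mink) × Mink).prod (𝓘(ℝ, E3).prod 𝓘(ℝ, F)))
      (𝓘(ℝ, E3).prod 𝓘(ℝ, F)) ∞ Φ (Set.range poincareCoords ×ˢ Set.univ)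
  smooth_inner : ∀ ψ χ : ∀ k, V k, IsSmoothSection F V ψ → IsSmoothSection F V χ →
    ContMDiff 𝓘(ℝ, E3) 𝓘(ℝ, ℂ) ∞ fun k => inner ℂ (ψ k) (χ k)
  unitary : ∀ (g : Poincare) (k : momentumSpace m) (v w : V k),
    inner ℂ (act g k v) (act g k w) = inner ℂ v w
  act_translation : ∀ (a : Mink) (k : momentumSpace m) (v : V k),
    (⟨translation a • k, act (translation a) k v⟩ : TotalSpace F V)
      = ⟨k, Complex.exp (Complex.I * (minkForm (fourMomentum k) a : ℝ)) • v⟩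
  rank_pos : 0 < Module.finrank ℂ F
  /-- There is no proper invariant subbundle. (The action on momenta is transitive, so that every
  invariant family of subspaces of the fibres is a smooth subbundle.) -/
  irreducible : ∀ W : ∀ k, Submodule ℂ (V k),
    (∀ (g : Poincare) (k : momentumSpace m) (v : V k), v ∈ W k → act g k v ∈ W (g • k)) →
    (∀ k, W k = ⊥) ∨ (∀ k, W k = ⊤)

/-- A smooth connection on the complex vector bundle: a covariant derivative that maps smooth
sections to smooth sections and is complex linear. The derivative `D_X ψ` at `𝐤` is
`D ψ k (X k)`. -/
structure Connection extends CovariantDerivative 𝓘(ℝ, E3) F V where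
  smooth : CovariantDerivative.ContMDiffCovariantDerivative toCovariantDerivative ∞
  map_smul : ∀ (c : ℂ) (ψ : ∀ k, V k), IsSmoothSection F V ψ → ∀ k v,
    toFun (fun k => c • ψ k) k v = c • toFun ψ k v

/-- Smooth vector fields on momentum space. -/
def IsSmoothField (X : ∀ k : momentumSpace m, TangentSpace 𝓘(ℝ, E3) k) : Prop :=
  ContMDiff 𝓘(ℝ, E3) (𝓘(ℝ, E3).prod 𝓘(ℝ, E3)) ∞
    fun k => (⟨k, X k⟩ : TangentBundle 𝓘(ℝ, E3) (momentumSpace m))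

/-- Vector fields transverse to `𝐤`, `X(𝐤) ⬝ 𝐤 = 0`. (For a smooth field on a space of momenta that
contains `𝐤 = 0`, this forces `X(0) = 0`.) -/
def IsTransverse (X : momentumSpace m → E3) : Prop := ∀ k, inner ℝ (X k) (k : E3) = 0

variable {F V}

/-- The vector field `𝐤 ↦ v × 𝐤`. -/
def crossField (v : E3) (k : momentumSpace m) : TangentSpace 𝓘(ℝ, E3) k := cross v k

namespace ParticleBundle

variable (E : ParticleBundle F V)

/-- The induced action on wave functions, `(Σ̃_g ψ)(𝐤) = Σ_g (ψ (g⁻¹ 𝐤))`. -/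
def actSection (g : Poincare) (ψ : ∀ k, V k) (k : momentumSpace m) : V k :=
  cast (congrArg V (smul_inv_smul g k)) (E.act g (g⁻¹ • k) (ψ (g⁻¹ • k)))

/-- The total angular momentum `J_a ψ = i d/dt|₀ Σ̃_{R_a(t)} ψ`. -/
def J (a : Fin 3) (ψ : ∀ k, V k) (k : momentumSpace m) : V k :=
  Complex.I • deriv (fun t : ℝ => E.actSection (rot a t).toPoincare ψ k) 0

end ParticleBundle

namespace Connection

variable (D : Connection F V)

/-- The covariant derivative `D_X ψ` along a vector field. -/
def along (X : ∀ k : momentumSpace m, TangentSpace 𝓘(ℝ, E3) k) (ψ : ∀ k, V k)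
    (k : momentumSpace m) : V k := D.toFun ψ k (X k)

/-- The curvature `F_D(X, Y) ψ = D_X D_Y ψ - D_Y D_X ψ - D_[X,Y] ψ`. -/
def curvature (X Y : ∀ k : momentumSpace m, TangentSpace 𝓘(ℝ, E3) k) (ψ : ∀ k, V k)
    (k : momentumSpace m) : V k :=
  D.along X (D.along Y ψ) k - D.along Y (D.along X ψ) k
    - D.along (VectorField.mlieBracket 𝓘(ℝ, E3) X Y) ψ k

/-- `D` is `S²`-flat: the curvature vanishes on all pairs of vector fields transverse to `𝐤`. -/
def IsS2Flat : Prop :=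
  ∀ X Y : ∀ k : momentumSpace m, TangentSpace 𝓘(ℝ, E3) k, IsSmoothField X → IsSmoothField Y →
    IsTransverse X → IsTransverse Y →
    ∀ ψ : ∀ k, V k, IsSmoothSection F V ψ → ∀ k, D.curvature X Y ψ k = 0

/-- `D` is rotationally symmetric: `D_{R X} = Σ̃_R D_X Σ̃_{R⁻¹}` for every rotation `R`, where
`(R X)(𝐤) = R (X (R⁻¹ 𝐤))`. -/
def IsRotationallySymmetric (E : ParticleBundle F V) : Prop :=
  ∀ (R : SO3) (X : ∀ k : momentumSpace m, TangentSpace 𝓘(ℝ, E3) k), IsSmoothField X →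
    ∀ ψ : ∀ k, V k, IsSmoothSection F V ψ →
      D.along (fun k => R.act (X (R.toPoincare⁻¹ • k))) ψ
        = E.actSection R.toPoincare (D.along X (E.actSection R.toPoincare⁻¹ ψ))

/-- The operator `L^D = -i 𝐤 × D`, with components `L_a = -i D_{e_a × 𝐤}`. -/
def L (a : Fin 3) (ψ : ∀ k, V k) (k : momentumSpace m) : V k :=
  -(Complex.I • D.along (crossField (e a)) ψ k)

/-- The operator `S^D = J - L^D`. -/
def S (E : ParticleBundle F V) (a : Fin 3) (ψ : ∀ k, V k) (k : momentumSpace m) : V k :=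
  E.J a ψ k - D.L a ψ k

end Connection

variable (F) in
/-- The `so(3)` relations `[A_a, A_b] = i ε_abc A_c` on smooth wave functions. -/
def AngularMomentumRelations (A : Fin 3 → (∀ k, V k) → ∀ k, V k) : Prop :=
  ∀ a b : Fin 3, ∀ ψ : ∀ k, V k, IsSmoothSection F V ψ → ∀ k : momentumSpace m,
    A a (A b ψ) k - A b (A a ψ) k = Complex.I • ∑ c, (eps a b c : ℂ) • A c ψ k

end Bundles

end

end Particle

open Particle

set_option linter.unusedSectionVars false

/-! Write `T_a` for the infinitesimal rotation `rotDeriv a`, so that `J_a = i T_a`, and `D_a` for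
the covariant derivative along `e_a × k`. Then `L_a = -i D_a` and `S_a = i (T_a + D_a)`, and
everything follows from three commutators. (i) `[D_a, D_b] = F_ab - ε_abc D_c`, where `F_ab` is the
curvature on the two rotation fields: this is the definition of curvature together with `[v × k, w ×
k] = -(v × w) × k` (`mlieBracket_crossField`). (ii) `[T_a, T_b] = ε_abc T_c`. (iii) `[T_a, D_b] =
ε_abc D_c` if `D` is rotationally symmetric. From (i), `[L_a, L_b] = i ε_abc L_c - F_ab`. In `[T_a +
D_a, T_b + D_b]` the mixed terms give `2 ε_abc D_c`, so the sum is `ε_abc (T_c + D_c) + F_ab` and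
`[S_a, S_b] = i ε_abc S_c - F_ab`. Both triples miss the angular momentum relations by the same
curvature term.

It remains to see that `F_ab = 0` for all `a`, `b` means `S²`-flatness (`isS2Flat_iff`). Curvature
is tensorial, and a smooth transverse field has at each point the value of some `w × k`; at `k = 0`
this holds because continuity forces the field to vanish there.

Relations (ii) and (iii) are both instances of `rotDeriv_commutator`: an operator triple that
rotates as a vector is differentiated along `R_a(t)`. That `T` itself rotates as a vector
(`actSection_rotDeriv`) comes from the Cayley parametrization, which is smooth in the axis vector
and equivariant under conjugation. The product rule also needs each operator to commute with the
derivative in a parameter; in a trivialization this is the symmetry of second derivatives. -/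

namespace Particle

/-! ### Rotations -/

lemma SO3.ofLp_act (R : SO3) (v : E3) : (R.act v).ofLp = R.1 *ᵥ v.ofLp := rfl

lemma ofLp_cross (v w : E3) : (cross v w).ofLp = v.ofLp ⨯₃ w.ofLp := rfl

/-- For determinant one the adjugate is the inverse. Hence every entry of a rotation equals its own
cofactor, which is what makes rotations respect the cross product. -/
lemma SO3.adjugate_eq_transpose (R : SO3) : R.1.adjugate = R.1ᵀ := by
  have hd : R.1.det = 1 := (Matrix.mem_specialOrthogonalGroup_iff.1 R.2).2
  calc R.1.adjugate = R.1.adjugate * (R.1 * R.1ᵀ) := by rw [R.mul_transpose, mul_one]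
    _ = R.1ᵀ := by rw [← mul_assoc, Matrix.adjugate_mul, hd, one_smul, one_mul]

lemma SO3.act_cross (R : SO3) (v w : E3) : R.act (cross v w) = cross (R.act v) (R.act w) := by
  have h : ∀ i j, R.1 i j = R.1.adjugate j i := fun i j => by
    rw [R.adjugate_eq_transpose]; rfl
  have h' := R.1.adjugate_fin_three
  ext i
  simp only [SO3.ofLp_act, ofLp_cross, cross_apply, Matrix.mulVec, dotProduct, Fin.sum_univ_three]
  rw [h i 0, h i 1, h i 2, h']
  fin_cases i <;> simp <;> ring

lemma SO3.one_act (v : E3) : (1 : SO3).act v = v := by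
  ext i; simp [SO3.act]

lemma SO3.mul_act (R S : SO3) (v : E3) : (R * S).act v = R.act (S.act v) := by
  ext i; simp [SO3.act, Matrix.mulVec_mulVec]

lemma SO3.act_inv_act (R : SO3) (v : E3) : R.act (R⁻¹.act v) = v := by
  rw [← SO3.mul_act, mul_inv_cancel, SO3.one_act]

lemma SO3.toPoincare_one : (1 : SO3).toPoincare = 1 := by
  apply Subtype.ext
  apply AffineEquiv.ext
  intro p
  exact Prod.ext rfl (SO3.one_act p.2)

lemma SO3.toPoincare_mul (R S : SO3) : (R * S).toPoincare = R.toPoincare * S.toPoincare := by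
  apply Subtype.ext
  apply AffineEquiv.ext
  intro p
  exact Prod.ext rfl (SO3.mul_act R S p.2)

lemma SO3.toPoincare_inv (R : SO3) : R⁻¹.toPoincare = R.toPoincare⁻¹ :=
  eq_inv_of_mul_eq_one_left (by rw [← SO3.toPoincare_mul, inv_mul_cancel, SO3.toPoincare_one])

lemma SO3.coe_toPoincare_smul {m : ℝ} (R : SO3) (k : momentumSpace m) :
    ((R.toPoincare • k : momentumSpace m) : E3) = R.act k := rfl

lemma SO3.coe_inv (R : SO3) : (R⁻¹).1 = R.1ᵀ := by
  have : (R⁻¹).1 * (R.1 * R.1ᵀ) = R.1ᵀ := by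
    rw [← mul_assoc]
    have : (R⁻¹).1 * R.1 = 1 := congrArg Subtype.val (inv_mul_cancel R)
    rw [this, one_mul]
  rwa [R.mul_transpose, mul_one] at this

lemma rot_zero (a : Fin 3) : rot a 0 = 1 := by
  apply Subtype.ext
  ext i j
  fin_cases a <;> fin_cases i <;> fin_cases j <;> simp [rot, rotMatrix]

lemma contDiff_rot (a i j : Fin 3) : ContDiff ℝ ∞ fun t => (rot a t).1 i j := by
  fin_cases a <;> fin_cases i <;> fin_cases j <;> simp [rot, rotMatrix] <;> fun_prop

/-- Source of the structure constants: the velocity of `R_a(t) e_b` at `t = 0` is `e_a × e_b`. -/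
lemma hasDerivAt_rot_act (a b c : Fin 3) :
    HasDerivAt (fun t => (rot a t).act (e b) c) (eps a b c) 0 := by
  have hc : HasDerivAt Real.cos 0 0 := by simpa using Real.hasDerivAt_cos 0
  have hs : HasDerivAt Real.sin 1 0 := by simpa using Real.hasDerivAt_sin 0
  have hs' : HasDerivAt (fun t => -Real.sin t) (-1) 0 := hs.neg
  fin_cases a <;> fin_cases b <;> fin_cases c <;>
    simp [rot, rotMatrix, SO3.act, e, eps, cross, cross_apply, hasDerivAt_const] <;> assumption

/-! ### Identities for the cross product -/

lemma cross_add_left (u v w : E3) : cross (u + v) w = cross u w + cross v w := by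
  ext i; simp [cross]

lemma cross_smul_left (r : ℝ) (v w : E3) : cross (r • v) w = r • cross v w := by
  ext i; simp [cross]

/-- The cross product with a fixed vector, as a continuous linear map. -/
noncomputable def crossCLM (v : E3) : E3 →L[ℝ] E3 :=
  LinearMap.toContinuousLinearMap
    { toFun := cross v
      map_add' := fun _ _ => by ext i; simp [cross]
      map_smul' := fun _ _ => by ext i; simp [cross] }

lemma sum_smul_e (v : E3) : ∑ c, v c • e c = v := by
  ext i
  fin_cases i <;> simp [e, Fin.sum_univ_three]

lemma cross_eq_sum (v w : E3) : cross v w = ∑ c, v c • cross (e c) w := by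
  conv_lhs => rw [← sum_smul_e v]
  simp only [Fin.sum_univ_three, cross_add_left, cross_smul_left]

lemma eps_eq_cross (a b c : Fin 3) : eps a b c = cross (e a) (e b) c := rfl

lemma eps_swap (a b c : Fin 3) : eps b a c = -eps a b c := by
  simp only [eps, cross, ← cross_anticomm (e a).ofLp]
  simp

/-- The Jacobi identity, in the form of the Lie bracket of two linear fields `v × w` and `u × w` in
the variable `w`. -/
lemma cross_leibniz (u v w : E3) :
    cross v (cross u w) - cross u (cross v w) = -cross (cross u v) w := by
  ext i
  fin_cases i <;> simp [cross, cross_apply] <;> ring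

/-- A vector orthogonal to `k ≠ 0` is of the form `w × k`. -/
lemma exists_cross_eq {k x : E3} (hk : k ≠ 0) (hx : inner ℝ x k = 0) : ∃ w, x = cross w k := by
  have hn : ‖k‖ ^ 2 ≠ 0 := by positivity
  have hn' : ‖k‖ ^ 2 = k 0 ^ 2 + k 1 ^ 2 + k 2 ^ 2 := by
    simp [EuclideanSpace.norm_sq_eq, Fin.sum_univ_three]
  have hx' : x 0 * k 0 + x 1 * k 1 + x 2 * k 2 = 0 := by
    simpa [PiLp.inner_apply, Fin.sum_univ_three, mul_comm] using hx
  refine ⟨(‖k‖ ^ 2)⁻¹ • cross k x, ?_⟩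
  -- Triple product expansion `(k × x) × k = |k|² x - (k ⬝ x) k`, whose last term vanishes.
  have key : ‖k‖ ^ 2 • x = cross (cross k x) k := by
    rw [hn']
    ext i
    fin_cases i <;> simp [cross, cross_apply]
    · linear_combination k 0 * hx'
    · linear_combination k 1 * hx'
    · linear_combination k 2 * hx'
  rw [cross_smul_left, ← key, inv_smul_smul₀ hn]

/-! ### The Cayley parametrization of rotations -/

/-- The rotation about the axis `u` by the angle `2 arctan ‖u‖`. -/
noncomputable def cayleyMatrix (u : E3) : Matrix (Fin 3) (Fin 3) ℝ :=
  (1 + u 0 ^ 2 + u 1 ^ 2 + u 2 ^ 2)⁻¹ •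
    !![1 + u 0 ^ 2 - u 1 ^ 2 - u 2 ^ 2, 2 * (u 0 * u 1 - u 2), 2 * (u 0 * u 2 + u 1);
      2 * (u 0 * u 1 + u 2), 1 - u 0 ^ 2 + u 1 ^ 2 - u 2 ^ 2, 2 * (u 1 * u 2 - u 0);
      2 * (u 0 * u 2 - u 1), 2 * (u 1 * u 2 + u 0), 1 - u 0 ^ 2 - u 1 ^ 2 + u 2 ^ 2]

lemma cayley_denom_pos (u : E3) : 0 < 1 + u 0 ^ 2 + u 1 ^ 2 + u 2 ^ 2 := by positivity

lemma cayleyMatrix_mem (u : E3) :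
    cayleyMatrix u ∈ Matrix.specialOrthogonalGroup (Fin 3) ℝ := by
  have h := (cayley_denom_pos u).ne'
  rw [Matrix.mem_specialOrthogonalGroup_iff, Matrix.mem_orthogonalGroup_iff]
  constructor
  · ext i j
    fin_cases i <;> fin_cases j <;>
      simp [cayleyMatrix, Matrix.mul_apply, Fin.sum_univ_three] <;> field_simp <;> ring
  · simp [cayleyMatrix, Matrix.det_fin_three]
    field_simp
    ring

/-- The Cayley parametrization of rotations. -/
noncomputable def cayley (u : E3) : SO3 := ⟨cayleyMatrix u, cayleyMatrix_mem u⟩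

lemma contDiff_cayley (i j : Fin 3) : ContDiff ℝ ∞ fun u => (cayley u).1 i j := by
  have h : ∀ u : E3, 1 + u 0 ^ 2 + u 1 ^ 2 + u 2 ^ 2 ≠ 0 := fun u => (cayley_denom_pos u).ne'
  have hi : ContDiff ℝ ∞ fun u : E3 => (1 + u 0 ^ 2 + u 1 ^ 2 + u 2 ^ 2)⁻¹ :=
    ContDiff.inv (by fun_prop) h
  fin_cases i <;> fin_cases j <;> simp [cayley, cayleyMatrix] <;>
    exact hi.mul (by fun_prop)

/-- Conjugation of `v` by the quaternion `1 + u`, cleared of its denominator. Only norm, inner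
product and cross product occur, so equivariance under rotations can be read off. -/
lemma cayley_act (u v : E3) : (1 + ‖u‖ ^ 2) • (cayley u).act v
    = (1 - ‖u‖ ^ 2) • v + (2 * inner ℝ u v) • u + (2 : ℝ) • cross u v := by
  have h := (cayley_denom_pos u).ne'
  have hn : ‖u‖ ^ 2 = u 0 ^ 2 + u 1 ^ 2 + u 2 ^ 2 := by
    simp [EuclideanSpace.norm_sq_eq, Fin.sum_univ_three]
  have hi : inner ℝ u v = u 0 * v 0 + u 1 * v 1 + u 2 * v 2 := by
    simp [PiLp.inner_apply, Fin.sum_univ_three, mul_comm]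
  rw [hn, hi, ← add_assoc, ← add_assoc]
  ext i
  fin_cases i <;>
    simp [cayley, cayleyMatrix, SO3.act, cross, cross_apply, dotProduct,
      Fin.sum_univ_three] <;> field_simp <;> ring

lemma SO3.act_add (R : SO3) (v w : E3) : R.act (v + w) = R.act v + R.act w := by
  ext i; simp [SO3.act, Matrix.mulVec_add]

lemma SO3.act_smul (R : SO3) (r : ℝ) (v : E3) : R.act (r • v) = r • R.act v := by
  ext i; simp [SO3.act, Matrix.mulVec_smul]

lemma SO3.norm_act (R : SO3) (v : E3) : ‖R.act v‖ = ‖v‖ := by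
  rw [@norm_eq_sqrt_real_inner E3, @norm_eq_sqrt_real_inner E3, R.inner_act]

lemma SO3.ext_act {R S : SO3} (h : ∀ v, R.act v = S.act v) : R = S := by
  apply Subtype.ext
  apply Matrix.toLin'.injective
  apply LinearMap.ext
  intro v
  exact congrArg WithLp.ofLp (h (WithLp.toLp 2 v))

lemma SO3.conj_cayley (R : SO3) (u : E3) : R * cayley u * R⁻¹ = cayley (R.act u) := by
  apply SO3.ext_act
  intro v
  have hp : (1 + ‖u‖ ^ 2) ≠ 0 := by positivity
  apply smul_right_injective E3 hp
  show (1 + ‖u‖ ^ 2) • (R * cayley u * R⁻¹).act v = (1 + ‖u‖ ^ 2) • (cayley (R.act u)).act v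
  obtain ⟨w, rfl⟩ : ∃ w, v = R.act w := ⟨R⁻¹.act v, (R.act_inv_act v).symm⟩
  have h1 : (R * cayley u * R⁻¹).act (R.act w) = R.act ((cayley u).act w) := by
    rw [← SO3.mul_act, ← SO3.mul_act, inv_mul_cancel_right]
  rw [h1, ← SO3.act_smul, cayley_act, ← R.norm_act u, cayley_act]
  simp only [SO3.act_add, SO3.act_smul, SO3.act_cross, SO3.inner_act]

/-- Half-angle formulas; the condition on the cosine excludes the half turns, which the Cayley
parametrization misses. -/
lemma rot_eq_cayley (a : Fin 3) {t : ℝ} (ht : Real.cos (t / 2) ≠ 0) :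
    rot a t = cayley (Real.tan (t / 2) • e a) := by
  have h2 : t = 2 * (t / 2) := by ring
  have hs : Real.sin (t / 2) ^ 2 = 1 - Real.cos (t / 2) ^ 2 := by
    linear_combination Real.sin_sq_add_cos_sq (t / 2)
  have hcos : Real.cos t = 2 * Real.cos (t / 2) ^ 2 - 1 := by
    conv_lhs => rw [h2, Real.cos_two_mul]
  have hsin : Real.sin t = 2 * Real.sin (t / 2) * Real.cos (t / 2) := by
    conv_lhs => rw [h2, Real.sin_two_mul]
  have hd : (1 + Real.tan (t / 2) ^ 2)⁻¹ = Real.cos (t / 2) ^ 2 := by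
    rw [Real.inv_one_add_tan_sq ht]
  have htan : Real.tan (t / 2) * Real.cos (t / 2) = Real.sin (t / 2) := Real.tan_mul_cos ht
  have hd' : Real.cos (t / 2) ^ 2 * (1 + Real.tan (t / 2) ^ 2) = 1 := by
    rw [← hd]; exact inv_mul_cancel₀ (by positivity)
  apply Subtype.ext
  ext i j
  fin_cases a <;> fin_cases i <;> fin_cases j <;>
    simp [rot, rotMatrix, cayley, cayleyMatrix, e, hd, hcos, hsin] <;>
    first
    | linear_combination hd'
    | linear_combination -hd'
    | linear_combination 2 * Real.cos (t / 2) * htan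
    | linear_combination -2 * Real.cos (t / 2) * htan

variable {m : ℝ} {F : Type*} [NormedAddCommGroup F] [NormedSpace ℂ F]
  {V : momentumSpace m → Type*} [∀ k, NormedAddCommGroup (V k)]
  [∀ k, InnerProductSpace ℂ (V k)] [TopologicalSpace (TotalSpace F V)] [FiberBundle F V]
  [VectorBundle ℂ F V] [VectorBundle ℝ F V] [ContMDiffVectorBundle ∞ F V 𝓘(ℝ, E3)]

/-! ### The action on wave functions -/

namespace ParticleBundle

variable (E : ParticleBundle F V)

/-- Stated in the total space, where the cast along `g g⁻¹ k = k` in `actSection` disappears. -/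
lemma mk_actSection (g : Poincare) (ψ : ∀ k, V k) (k : momentumSpace m) :
    (⟨k, E.actSection g ψ k⟩ : TotalSpace F V)
      = ⟨g • g⁻¹ • k, E.act g (g⁻¹ • k) (ψ (g⁻¹ • k))⟩ := by
  have key : ∀ (k' : momentumSpace m) (h : k' = k) (v : V k'),
      (⟨k, cast (congrArg V h) v⟩ : TotalSpace F V) = ⟨k', v⟩ := by
    rintro k' rfl v; rfl
  exact key _ (smul_inv_smul g k) _

lemma actSection_smul_apply (g : Poincare) (ψ : ∀ k, V k) (k : momentumSpace m) :
    E.actSection g ψ (g • k) = E.act g k (ψ k) := by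
  have h := E.mk_actSection g ψ (g • k)
  rw [inv_smul_smul] at h
  exact eq_of_heq (TotalSpace.mk.inj h).2

lemma actSection_one (ψ : ∀ k, V k) : E.actSection 1 ψ = ψ := by
  funext k
  have h := E.mk_actSection 1 ψ k
  rw [E.act_one, inv_one, one_smul] at h
  exact eq_of_heq (TotalSpace.mk.inj h).2

lemma actSection_mul (g h : Poincare) (ψ : ∀ k, V k) :
    E.actSection (g * h) ψ = E.actSection g (E.actSection h ψ) := by
  funext k
  obtain ⟨k, rfl⟩ : ∃ k', k = g • h • k' := ⟨h⁻¹ • g⁻¹ • k, by simp⟩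
  rw [actSection_smul_apply, actSection_smul_apply]
  have h1 := E.mk_actSection (g * h) ψ ((g * h) • k)
  rw [inv_smul_smul, E.act_mul, mul_smul] at h1
  exact eq_of_heq (TotalSpace.mk.inj h1).2

lemma actSection_add (g : Poincare) (ψ χ : ∀ k, V k) :
    E.actSection g (ψ + χ) = E.actSection g ψ + E.actSection g χ := by
  funext k
  obtain ⟨k, rfl⟩ : ∃ k', k = g • k' := ⟨g⁻¹ • k, by simp⟩
  simp only [Pi.add_apply, actSection_smul_apply, map_add]

lemma actSection_smul (g : Poincare) (c : ℂ) (ψ : ∀ k, V k) :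
    E.actSection g (c • ψ) = c • E.actSection g ψ := by
  funext k
  obtain ⟨k, rfl⟩ : ∃ k', k = g • k' := ⟨g⁻¹ • k, by simp⟩
  simp only [Pi.smul_apply, actSection_smul_apply, map_smul]

end ParticleBundle

/-! ### Smooth families of sections -/

/-- Families of sections depending smoothly on a parameter. -/
def IsSmoothFamily {P : Type*} [NormedAddCommGroup P] [NormedSpace ℝ P]
    (F : Type*) [NormedAddCommGroup F] [NormedSpace ℂ F]
    {V : momentumSpace m → Type*} [∀ k, NormedAddCommGroup (V k)]
    [TopologicalSpace (TotalSpace F V)] [FiberBundle F V]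
    (σ : P → ∀ k, V k) : Prop :=
  ContMDiff (𝓘(ℝ, P).prod 𝓘(ℝ, E3)) (𝓘(ℝ, E3).prod 𝓘(ℝ, F)) ∞
    fun q : P × momentumSpace m => (⟨q.2, σ q.1 q.2⟩ : TotalSpace F V)

section Families

variable {P : Type*} [NormedAddCommGroup P] [NormedSpace ℝ P]

lemma isSmoothFamily_const {ψ : ∀ k, V k} (hψ : IsSmoothSection F V ψ) :
    IsSmoothFamily F (fun _ : P => ψ) :=
  ContMDiff.comp hψ contMDiff_snd

lemma IsSmoothFamily.comp {Q : Type*} [NormedAddCommGroup Q] [NormedSpace ℝ Q]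
    {σ : P → ∀ k, V k} (hσ : IsSmoothFamily F σ) {f : Q → P} (hf : ContDiff ℝ ∞ f) :
    IsSmoothFamily F fun x => σ (f x) :=
  ContMDiff.comp (I' := 𝓘(ℝ, P).prod 𝓘(ℝ, E3)) hσ
    ((hf.contMDiff.comp contMDiff_fst).prodMk contMDiff_snd)

/-- A section near `k₀`, in the preferred trivialization at `k₀`. -/
noncomputable def localSection (F : Type*) [NormedAddCommGroup F]
    {V : momentumSpace m → Type*} [∀ k, NormedAddCommGroup (V k)]
    [TopologicalSpace (TotalSpace F V)] [FiberBundle F V]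
    (ψ : ∀ k, V k) (k₀ : momentumSpace m) (y : E3) : F :=
  (trivializationAt F V k₀
    ⟨(extChartAt 𝓘(ℝ, E3) k₀).symm y, ψ ((extChartAt 𝓘(ℝ, E3) k₀).symm y)⟩).2

/-- A family of sections near `k₀`, in the preferred trivialization at `k₀`. -/
noncomputable def localFamily (F : Type*) [NormedAddCommGroup F]
    {V : momentumSpace m → Type*} [∀ k, NormedAddCommGroup (V k)]
    [TopologicalSpace (TotalSpace F V)] [FiberBundle F V]
    (σ : P → ∀ k, V k) (k₀ : momentumSpace m) (q : P × E3) : F :=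
  localSection F (σ q.1) k₀ q.2

/-- Every chart of the open set is the inclusion into `ℝ³`, so the inverse chart at `k₀` recovers
all points, not only those near `k₀`. -/
lemma extChartAt_symm_coe (k₀ k : momentumSpace m) :
    (extChartAt 𝓘(ℝ, E3) k₀).symm (k : E3) = k := by
  have h : extChartAt 𝓘(ℝ, E3) k₀ k = (k : E3) := rfl
  rw [← h]
  apply (extChartAt 𝓘(ℝ, E3) k₀).left_inv
  rw [extChartAt_source, TopologicalSpace.Opens.chartAt_eq,
    OpenPartialHomeomorph.subtypeRestr_source]
  exact Set.mem_univ _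

lemma contMDiffAt_extChartAt_symm_coe (k₀ : momentumSpace m) :
    ContMDiffAt 𝓘(ℝ, E3) 𝓘(ℝ, E3) ∞ (extChartAt 𝓘(ℝ, E3) k₀).symm (k₀ : E3) :=
  (contMDiffOn_extChartAt_symm k₀).contMDiffAt
    (extChartAt_target_mem_nhds (I := 𝓘(ℝ, E3)) k₀)

lemma localSection_coe (ψ : ∀ k, V k) (k₀ k : momentumSpace m) :
    localSection F ψ k₀ k = (trivializationAt F V k₀ ⟨k, ψ k⟩).2 := by
  have key : ∀ k', k' = k → (trivializationAt F V k₀ ⟨k', ψ k'⟩).2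
      = (trivializationAt F V k₀ ⟨k, ψ k⟩).2 := by rintro _ rfl; rfl
  exact key _ (extChartAt_symm_coe k₀ k)

lemma localFamily_coe (σ : P → ∀ k, V k) (k₀ k : momentumSpace m) (t : P) :
    localFamily F σ k₀ (t, k) = (trivializationAt F V k₀ ⟨k, σ t k⟩).2 :=
  localSection_coe (σ t) k₀ k

lemma IsSmoothFamily.contDiffAt_localFamily {σ : P → ∀ k, V k} (hσ : IsSmoothFamily F σ)
    (t : P) (k₀ : momentumSpace m) : ContDiffAt ℝ ∞ (localFamily F σ k₀) (t, k₀) := by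
  have h1 : ContMDiffAt 𝓘(ℝ, P × E3) (𝓘(ℝ, P).prod 𝓘(ℝ, E3)) ∞
      (fun q : P × E3 => (q.1, (extChartAt 𝓘(ℝ, E3) k₀).symm q.2)) (t, (k₀ : E3)) := by
    refine ContMDiffAt.prodMk contDiff_fst.contMDiff.contMDiffAt ?_
    exact ContMDiffAt.comp (t, (k₀ : E3)) (contMDiffAt_extChartAt_symm_coe k₀)
      contDiff_snd.contMDiff.contMDiffAt
  have h2 := hσ.contMDiffAt (x := (t, k₀))
  rw [contMDiffAt_totalSpace] at h2
  have h3 := h2.2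
  rw [← contMDiffAt_iff_contDiffAt]
  exact ContMDiffAt.comp_of_eq
    (g := fun q : P × momentumSpace m => (trivializationAt F V k₀ ⟨q.2, σ q.1 q.2⟩).2)
    (f := fun q : P × E3 => (q.1, (extChartAt 𝓘(ℝ, E3) k₀).symm q.2))
    h3 h1 (congrArg (Prod.mk t) (extChartAt_symm_coe k₀ k₀))

/-- The preferred trivialization at `k₀`, on the fibre over a nearby point. -/
noncomputable def fibreEquiv (F : Type*) [NormedAddCommGroup F] [NormedSpace ℂ F]
    {V : momentumSpace m → Type*} [∀ k, NormedAddCommGroup (V k)]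
    [∀ k, InnerProductSpace ℂ (V k)] [TopologicalSpace (TotalSpace F V)] [FiberBundle F V]
    [VectorBundle ℝ F V] (k₀ k : momentumSpace m)
    (hk : k ∈ (trivializationAt F V k₀).baseSet) : V k ≃L[ℝ] F :=
  (trivializationAt F V k₀).continuousLinearEquivAt ℝ k hk

lemma fibreEquiv_apply (k₀ k : momentumSpace m)
    (hk : k ∈ (trivializationAt F V k₀).baseSet) (v : V k) :
    fibreEquiv F k₀ k hk v = (trivializationAt F V k₀ ⟨k, v⟩).2 := rfl

lemma IsSmoothFamily.eq_symm_localFamily (σ : P → ∀ k, V k)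
    (k₀ k : momentumSpace m) (hk : k ∈ (trivializationAt F V k₀).baseSet) (t : P) :
    σ t k = (fibreEquiv F k₀ k hk).symm (localFamily F σ k₀ (t, k)) := by
  rw [ContinuousLinearEquiv.eq_symm_apply, fibreEquiv_apply, localFamily_coe]

lemma IsSmoothFamily.contDiff {σ : P → ∀ k, V k} (hσ : IsSmoothFamily F σ)
    (k : momentumSpace m) : ContDiff ℝ ∞ fun t => σ t k := by
  have hk := FiberBundle.mem_baseSet_trivializationAt F V k
  have h : (fun t => σ t k) = fun t => (fibreEquiv F k k hk).symm (localFamily F σ k (t, k)) :=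
    funext fun t => eq_symm_localFamily σ k k hk t
  rw [h]
  refine ContDiff.comp (g := (fibreEquiv F k k hk).symm) (ContinuousLinearEquiv.contDiff _) ?_
  rw [contDiff_iff_contDiffAt]
  intro t
  exact ContDiffAt.comp (g := localFamily F σ k) (f := fun t => (t, (k : E3))) t
    (hσ.contDiffAt_localFamily t k) (contDiffAt_id.prodMk contDiffAt_const)

lemma IsSmoothFamily.isSmoothSection {σ : P → ∀ k, V k} (hσ : IsSmoothFamily F σ) (t : P) :
    IsSmoothSection F V (σ t) :=
  ContMDiff.comp (I' := 𝓘(ℝ, P).prod 𝓘(ℝ, E3)) hσ (contMDiff_const.prodMk contMDiff_id)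

/-- The derivative of a family of sections with respect to a real parameter. -/
noncomputable def familyDeriv (σ : ℝ → ∀ k, V k) (k : momentumSpace m) : V k :=
  deriv (fun t => σ t k) 0

lemma IsSmoothFamily.hasDerivAt {σ : ℝ → ∀ k, V k} (hσ : IsSmoothFamily F σ)
    (k : momentumSpace m) : HasDerivAt (fun t => σ t k) (familyDeriv σ k) 0 :=
  ((hσ.contDiff k).differentiable (by simp)).differentiableAt.hasDerivAt

/-- On a fixed fibre the trivialization is continuous linear and independent of the parameter, so it
commutes with `d/dt`. -/
lemma IsSmoothFamily.fibreEquiv_familyDeriv {σ : ℝ → ∀ k, V k} (hσ : IsSmoothFamily F σ)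
    (k₀ k : momentumSpace m) (hk : k ∈ (trivializationAt F V k₀).baseSet) :
    (trivializationAt F V k₀ ⟨k, familyDeriv σ k⟩).2
      = deriv (fun t => localFamily F σ k₀ (t, k)) 0 := by
  rw [← fibreEquiv_apply k₀ k hk]
  have h := ((fibreEquiv F k₀ k hk : V k →L[ℝ] F).hasFDerivAt.comp_hasDerivAt 0
    (hσ.hasDerivAt k)).deriv
  simp only [Function.comp_def, ContinuousLinearEquiv.coe_coe, fibreEquiv_apply,
    ← localFamily_coe (F := F) σ k₀] at h
  exact h.symm

/-! ### Partial derivatives in a parameter and in a space variable -/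

section PartialDerivatives

variable {X Y : Type*} [NormedAddCommGroup X] [NormedSpace ℝ X]
  [NormedAddCommGroup Y] [NormedSpace ℝ Y] {f : ℝ × X → Y} {x : X}

lemma eventually_differentiableAt_of_contDiffAt (hf : ContDiffAt ℝ ∞ f (0, x)) :
    ∀ᶠ q in nhds ((0 : ℝ), x), DifferentiableAt ℝ f q := by
  filter_upwards [(hf.of_le (m := 1) (by simp)).eventually (by simp)] with q hq
  exact hq.differentiableAt (by simp)

lemma deriv_left_eventuallyEq (hf : ContDiffAt ℝ ∞ f (0, x)) :
    (fun y => deriv (fun t => f (t, y)) 0) =ᶠ[nhds x] fun y => fderiv ℝ f (0, y) (1, 0) := by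
  have hc : Filter.Tendsto (fun y : X => ((0 : ℝ), y)) (nhds x) (nhds (0, x)) :=
    (Continuous.prodMk continuous_const continuous_id).tendsto x
  filter_upwards [hc.eventually (eventually_differentiableAt_of_contDiffAt hf)] with y hy
  exact (HasFDerivAt.comp_hasDerivAt (l := f) (f := fun t : ℝ => (t, y)) (0 : ℝ) hy.hasFDerivAt
    ((hasDerivAt_id (0 : ℝ)).prodMk (hasDerivAt_const (0 : ℝ) y))).deriv

lemma fderiv_right_eventuallyEq (hf : ContDiffAt ℝ ∞ f (0, x)) (v : X) :
    (fun t => fderiv ℝ (fun y => f (t, y)) x v) =ᶠ[nhds 0] fun t => fderiv ℝ f (t, x) (0, v) := by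
  have hc : Filter.Tendsto (fun t : ℝ => (t, x)) (nhds 0) (nhds (0, x)) :=
    (Continuous.prodMk continuous_id continuous_const).tendsto 0
  filter_upwards [hc.eventually (eventually_differentiableAt_of_contDiffAt hf)] with t ht
  have h := (HasFDerivAt.comp (g := f) (f := fun y => (t, y)) x ht.hasFDerivAt
    (hasFDerivAt_prodMk_right t x)).fderiv
  exact DFunLike.congr_fun h v

lemma contDiffAt_deriv_left (hf : ContDiffAt ℝ ∞ f (0, x)) :
    ContDiffAt ℝ ∞ (fun y => deriv (fun t => f (t, y)) 0) x := by
  refine ContDiffAt.congr_of_eventuallyEq ?_ (deriv_left_eventuallyEq hf)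
  have h3 : ContDiffAt ℝ ∞ (fderiv ℝ f) (0, x) := hf.fderiv_right (by rfl)
  exact (ContDiffAt.comp (g := fderiv ℝ f) (f := fun y => ((0 : ℝ), y)) x h3
    (contDiffAt_const.prodMk contDiffAt_id)).clm_apply contDiffAt_const

/-- Mixed partial derivatives commute. -/
lemma hasDerivAt_fderiv_right (hf : ContDiffAt ℝ ∞ f (0, x)) (v : X) :
    HasDerivAt (fun t => fderiv ℝ (fun y => f (t, y)) x v)
      (fderiv ℝ (fun y => deriv (fun t => f (t, y)) 0) x v) 0 := by
  have h3 : DifferentiableAt ℝ (fderiv ℝ f) (0, x) :=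
    (hf.fderiv_right (m := ∞) (by rfl)).differentiableAt (by simp)
  have h4 : HasFDerivAt (fun y => fderiv ℝ f (0, y))
      (fderiv ℝ (fderiv ℝ f) (0, x) ∘L ContinuousLinearMap.inr ℝ ℝ X) x :=
    HasFDerivAt.comp (g := fderiv ℝ f) (f := fun y => ((0 : ℝ), y)) x h3.hasFDerivAt
      (hasFDerivAt_prodMk_right 0 x)
  have h4' : fderiv ℝ (fun y => fderiv ℝ f (0, y) (1, 0)) x v
      = fderiv ℝ (fderiv ℝ f) (0, x) (0, v) (1, 0) := by
    rw [(h4.clm_apply (hasFDerivAt_const ((1 : ℝ), (0 : X)) x)).fderiv]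
    simp
  have h5 : HasDerivAt (fun t => fderiv ℝ f (t, x)) (fderiv ℝ (fderiv ℝ f) (0, x) (1, 0)) 0 :=
    HasFDerivAt.comp_hasDerivAt (l := fderiv ℝ f) (f := fun t : ℝ => (t, x)) (0 : ℝ)
      h3.hasFDerivAt ((hasDerivAt_id (0 : ℝ)).prodMk (hasDerivAt_const (0 : ℝ) x))
  have h5' : HasDerivAt (fun t => fderiv ℝ f (t, x) (0, v))
      (fderiv ℝ (fderiv ℝ f) (0, x) (1, 0) (0, v)) 0 := by
    simpa using h5.clm_apply (hasDerivAt_const (0 : ℝ) ((0 : ℝ), v))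
  -- Symmetry of the second derivative exchanges the directions `(1, 0)` and `(0, v)`.
  have hsymm : IsSymmSndFDerivAt ℝ f (0, x) := hf.isSymmSndFDerivAt <| by
    rw [minSmoothness_of_isRCLikeNormedField]
    exact WithTop.coe_le_coe.2 (le_top : (2 : ℕ∞) ≤ ⊤)
  rw [(deriv_left_eventuallyEq hf).fderiv_eq, h4', hsymm.eq]
  exact h5'.congr_of_eventuallyEq (fderiv_right_eventuallyEq hf v)

end PartialDerivatives

/-- Ensures that infinitesimal rotations preserve smooth sections, so that they can be composed. -/
lemma IsSmoothFamily.isSmoothSection_familyDeriv {σ : ℝ → ∀ k, V k} (hσ : IsSmoothFamily F σ) :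
    IsSmoothSection F V (familyDeriv σ) := by
  intro k₀
  rw [contMDiffAt_totalSpace]
  refine ⟨contMDiffAt_id, ?_⟩
  have h := contDiffAt_deriv_left (hσ.contDiffAt_localFamily 0 k₀)
  have h' : ContMDiffAt 𝓘(ℝ, E3) 𝓘(ℝ, F) ∞
      (fun k : momentumSpace m => deriv (fun t => localFamily F σ k₀ (t, k)) 0) k₀ :=
    h.contMDiffAt.comp k₀ contMDiff_subtype_val.contMDiffAt
  refine h'.congr_of_eventuallyEq ?_
  filter_upwards [(trivializationAt F V k₀).open_baseSet.mem_nhds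
    (FiberBundle.mem_baseSet_trivializationAt F V k₀)] with k hk
  exact hσ.fibreEquiv_familyDeriv k₀ k hk

/-- Near `k₀`, the derivative of a family is computed in the trivialization. -/
lemma IsSmoothFamily.localSection_familyDeriv {σ : ℝ → ∀ k, V k} (hσ : IsSmoothFamily F σ)
    (k₀ : momentumSpace m) : localSection F (familyDeriv σ) k₀ =ᶠ[nhds (k₀ : E3)]
      fun y => deriv (fun t => localFamily F σ k₀ (t, y)) 0 := by
  have h : ((↑) : momentumSpace m → E3) '' (trivializationAt F V k₀).baseSet
      ∈ nhds (k₀ : E3) :=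
    ((momentumSpace m).isOpen.isOpenMap_subtype_val _
      (trivializationAt F V k₀).open_baseSet).mem_nhds
      ⟨k₀, FiberBundle.mem_baseSet_trivializationAt F V k₀, rfl⟩
  filter_upwards [h]
  rintro _ ⟨k, hk, rfl⟩
  rw [localSection_coe]
  exact hσ.fibreEquiv_familyDeriv k₀ k hk

end Families

/-! ### Connections -/

lemma IsSmoothSection.mdifferentiableAt {ψ : ∀ k, V k} (hψ : IsSmoothSection F V ψ)
    (k : momentumSpace m) : MDifferentiableAt 𝓘(ℝ, E3) (𝓘(ℝ, E3).prod 𝓘(ℝ, F))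
      (fun k => (⟨k, ψ k⟩ : TotalSpace F V)) k :=
  (ContMDiff.contMDiffAt hψ).mdifferentiableAt (by simp)

lemma IsSmoothField.mdifferentiableAt {X : ∀ k : momentumSpace m, TangentSpace 𝓘(ℝ, E3) k}
    (hX : IsSmoothField X) (k : momentumSpace m) :
    MDifferentiableAt 𝓘(ℝ, E3) (𝓘(ℝ, E3).prod 𝓘(ℝ, E3))
      (fun k => (⟨k, X k⟩ : TangentBundle 𝓘(ℝ, E3) (momentumSpace m))) k :=
  (ContMDiff.contMDiffAt hX).mdifferentiableAt (by simp)

namespace Connection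

variable (D : Connection F V)

lemma contMDiff_toFun {ψ : ∀ k, V k} (hψ : IsSmoothSection F V ψ) :
    ContMDiff 𝓘(ℝ, E3) (𝓘(ℝ, E3).prod 𝓘(ℝ, E3 →L[ℝ] F)) ∞ fun k =>
      (⟨k, D.toFun ψ k⟩ : TotalSpace (E3 →L[ℝ] F)
        fun k : momentumSpace m => TangentSpace 𝓘(ℝ, E3) k →L[ℝ] V k) := by
  rw [← contMDiffOn_univ]
  exact D.smooth.contMDiff.contMDiff (ContMDiff.contMDiffOn hψ)

lemma isSmoothSection_along {X : ∀ k : momentumSpace m, TangentSpace 𝓘(ℝ, E3) k}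
    (hX : IsSmoothField X) {ψ : ∀ k, V k} (hψ : IsSmoothSection F V ψ) :
    IsSmoothSection F V (D.along X ψ) :=
  ContMDiff.clm_bundle_apply (b := fun k : momentumSpace m => k) (D.contMDiff_toFun hψ) hX

lemma mdifferentiableAt_along {X : ∀ k : momentumSpace m, TangentSpace 𝓘(ℝ, E3) k}
    {k : momentumSpace m} (hX : MDifferentiableAt 𝓘(ℝ, E3) (𝓘(ℝ, E3).prod 𝓘(ℝ, E3))
      (fun k => (⟨k, X k⟩ : TangentBundle 𝓘(ℝ, E3) (momentumSpace m))) k)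
    {ψ : ∀ k, V k} (hψ : IsSmoothSection F V ψ) :
    MDifferentiableAt 𝓘(ℝ, E3) (𝓘(ℝ, E3).prod 𝓘(ℝ, F))
      (fun k => (⟨k, D.along X ψ k⟩ : TotalSpace F V)) k :=
  MDifferentiableAt.clm_bundle_apply (b := fun k : momentumSpace m => k)
    ((D.contMDiff_toFun hψ).contMDiffAt.mdifferentiableAt (by simp)) hX

/-! ### Tensoriality of the curvature, and covariant derivatives in a local frame -/

variable [FiniteDimensional ℂ F]

/-- The curvature is tensorial in its first argument. -/
lemma tensorialAt_curvature_left (Y : ∀ k : momentumSpace m, TangentSpace 𝓘(ℝ, E3) k)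
    {ψ : ∀ k, V k} (hψ : IsSmoothSection F V ψ) (k : momentumSpace m) :
    TensorialAt 𝓘(ℝ, E3) E3 (fun X => D.curvature X Y ψ k) k where
  smul := by
    intro f X hf hX
    have h1 : D.along (f • X) ψ = f • D.along X ψ := by
      funext k'
      simp [along]
    -- The Leibniz term `(Y f) D_X ψ` from `D_Y (f D_X ψ)` cancels against the one from `[f X, Y] =
    -- f [X, Y] - (Y f) X`.
    have h2 := D.isCovariantDerivativeOnUniv.leibniz (D.mdifferentiableAt_along hX hψ) hf
    have h3 := VectorField.mlieBracket_smul_left (W := Y) hf hX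
    simp only [curvature]
    rw [h1]
    simp only [along] at h2 ⊢
    rw [h2, h3]
    simp
    module
  add := by
    intro X X' hX hX'
    have h1 : D.along (X + X') ψ = D.along X ψ + D.along X' ψ := by
      funext k'
      simp [along]
    have h2 := D.isCovariantDerivativeOnUniv.add (D.mdifferentiableAt_along hX hψ)
      (D.mdifferentiableAt_along hX' hψ)
    simp only [curvature]
    rw [h1]
    have h3 := VectorField.mlieBracket_add_left (W := Y) hX hX'
    simp only [along] at h2 ⊢
    rw [h2, h3]
    simp
    abel

lemma curvature_swap (X Y : ∀ k : momentumSpace m, TangentSpace 𝓘(ℝ, E3) k) (ψ : ∀ k, V k)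
    (k : momentumSpace m) : D.curvature Y X ψ k = -D.curvature X Y ψ k := by
  simp only [curvature]
  rw [VectorField.mlieBracket_swap]
  simp [along]
  abel

/-- The curvature is tensorial in its second argument. -/
lemma tensorialAt_curvature_right (X : ∀ k : momentumSpace m, TangentSpace 𝓘(ℝ, E3) k)
    {ψ : ∀ k, V k} (hψ : IsSmoothSection F V ψ) (k : momentumSpace m) :
    TensorialAt 𝓘(ℝ, E3) E3 (fun Y => D.curvature X Y ψ k) k where
  smul := by
    intro f Y hf hY
    have h := (D.tensorialAt_curvature_left X hψ k).smul hf hY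
    simp only [D.curvature_swap X] at h
    simpa using h
  add := by
    intro Y Y' hY hY'
    have h := (D.tensorialAt_curvature_left X hψ k).add hY hY'
    simp only [D.curvature_swap X] at h
    rw [← neg_add, neg_inj] at h
    exact h

/-- The covariant derivative of a finite sum of sections. -/
lemma toFun_sum {ι : Type*} (s : Finset ι) {k : momentumSpace m} (ψ : ι → ∀ k, V k)
    (hψ : ∀ i ∈ s, MDifferentiableAt 𝓘(ℝ, E3) (𝓘(ℝ, E3).prod 𝓘(ℝ, F))
      (fun k => (⟨k, ψ i k⟩ : TotalSpace F V)) k) :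
    D.toFun (fun k' => ∑ i ∈ s, ψ i k') k = ∑ i ∈ s, D.toFun (ψ i) k := by
  classical
  induction s using Finset.induction_on with
  | empty =>
    simp only [Finset.sum_empty]
    exact D.isCovariantDerivativeOnUniv.zero
  | insert a s ha ih =>
    rw [Finset.forall_mem_insert] at hψ
    simp only [Finset.sum_insert ha]
    rw [← ih hψ.2]
    exact D.isCovariantDerivativeOnUniv.add hψ.1 (MDifferentiableAt.sum_section hψ.2)

/-- Since charts are inclusions, the manifold derivative of a coordinate function of `ψ` is an
ordinary Fréchet derivative on `ℝ³`. -/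
lemma mvfderiv_coord_eq {ψ : ∀ k, V k} (hψ : IsSmoothSection F V ψ) (k : momentumSpace m)
    (v : TangentSpace 𝓘(ℝ, E3) k) (l : F →L[ℝ] ℝ) :
    MDifferentiableAt 𝓘(ℝ, E3) 𝓘(ℝ, ℝ)
      (fun k' => l (trivializationAt F V k ⟨k', ψ k'⟩).2) k ∧
    mvfderiv 𝓘(ℝ, E3) (fun k' => l (trivializationAt F V k ⟨k', ψ k'⟩).2) k v
      = l (fderiv ℝ (localSection F ψ k) k v) := by
  have h1 : MDifferentiableAt 𝓘(ℝ, E3) 𝓘(ℝ, F)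
      (fun k' => (trivializationAt F V k ⟨k', ψ k'⟩).2) k :=
    ((contMDiffAt_totalSpace.1 (ContMDiff.contMDiffAt hψ)).2).mdifferentiableAt (by simp)
  have h2 : MDifferentiableAt 𝓘(ℝ, E3) 𝓘(ℝ, ℝ)
      (fun k' => l (trivializationAt F V k ⟨k', ψ k'⟩).2) k :=
    MDifferentiableAt.comp (I' := 𝓘(ℝ, F)) k l.differentiableAt.mdifferentiableAt h1
  have h3 : DifferentiableAt ℝ (localSection F ψ k) (k : E3) := by
    have hσ : IsSmoothFamily F (fun _ : ℝ => ψ) := isSmoothFamily_const hψ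
    exact DifferentiableAt.comp (g := localFamily F (fun _ : ℝ => ψ) k)
      (f := fun y => ((0 : ℝ), y)) _ ((hσ.contDiffAt_localFamily 0 k).differentiableAt (by simp))
      (by fun_prop)
  refine ⟨h2, ?_⟩
  have h4 : mfderiv 𝓘(ℝ, E3) 𝓘(ℝ, ℝ) (fun k' => l (trivializationAt F V k ⟨k', ψ k'⟩).2) k
      = fderiv ℝ (fun y => l (localSection F ψ k y)) (k : E3) := by
    rw [h2.mfderiv]
    simp only [modelWithCornersSelf_coe, Set.range_id, fderivWithin_univ]
    rfl
  have h5 : fderiv ℝ (fun y => l (localSection F ψ k y)) (k : E3)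
      = l ∘L fderiv ℝ (localSection F ψ k) k := (l.hasFDerivAt.comp _ h3.hasFDerivAt).fderiv
  simp only [mvfderiv, h4, h5]
  rfl

/-- The covariant derivative of a section in terms of a local frame. -/
lemma toFun_eq_sum {ψ : ∀ k, V k} (hψ : IsSmoothSection F V ψ) (k : momentumSpace m)
    (v : TangentSpace 𝓘(ℝ, E3) k) {ι : Type*} [Fintype ι] (b : Module.Basis ι ℝ F) :
    D.toFun ψ k v = ∑ i,
      (b.coord i (localSection F ψ k k)
          • D.toFun ((trivializationAt F V k).localFrame b i) k v
        + b.coord i (fderiv ℝ (localSection F ψ k) k v)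
          • (trivializationAt F V k).localFrame b i k) := by
  set e := trivializationAt F V k with he
  have hk : k ∈ e.baseSet := FiberBundle.mem_baseSet_trivializationAt F V k
  let l : ι → F →L[ℝ] ℝ := fun i => LinearMap.toContinuousLinearMap (b.coord i)
  let c : ι → momentumSpace m → ℝ := fun i k' => l i (e ⟨k', ψ k'⟩).2
  have hs : ∀ i, MDifferentiableAt 𝓘(ℝ, E3) (𝓘(ℝ, E3).prod 𝓘(ℝ, F))
      (fun k => (⟨k, e.localFrame b i k⟩ : TotalSpace F V)) k := fun i =>
    (contMDiffAt_localFrame_of_mem ∞ e b i hk).mdifferentiableAt (by simp)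
  have hc := fun i => mvfderiv_coord_eq hψ k v (l i)
  have hcs : ∀ i ∈ Finset.univ, MDifferentiableAt 𝓘(ℝ, E3) (𝓘(ℝ, E3).prod 𝓘(ℝ, F))
      (fun k => (⟨k, (c i • e.localFrame b i) k⟩ : TotalSpace F V)) k := fun i _ =>
    (hc i).1.smul_section (hs i)
  have h1 : ∀ᶠ k' in nhds k, ψ k' = ∑ i, (c i • e.localFrame b i) k' := by
    filter_upwards [e.open_baseSet.mem_nhds hk] with k' hk'
    conv_lhs => rw [← (e.basisAt b hk').sum_repr (ψ k')]
    refine Finset.sum_congr rfl fun i _ => ?_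
    simp [c, l, hk', Trivialization.basisAt]
  -- The frame expansion holds only near `k`; connections are local, so this suffices.
  have h2 := D.isCovariantDerivativeOnUniv.congr_of_eventuallyEq (hψ.mdifferentiableAt k)
    (MDifferentiableAt.sum_section hcs) Filter.univ_mem h1
  rw [h2, D.toFun_sum _ _ hcs, _root_.sum_apply]
  refine Finset.sum_congr rfl fun i _ => ?_
  rw [D.isCovariantDerivativeOnUniv.leibniz (hs i) (hc i).1, localSection_coe]
  simp only [_root_.add_apply, _root_.smul_apply,
    ContinuousLinearMap.smulRight_apply]
  congr 2
  exact (hc i).2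

/-- Covariant derivatives commute with the derivative with respect to a parameter. -/
lemma hasDerivAt_toFun {σ : ℝ → ∀ k, V k} (hσ : IsSmoothFamily F σ) (k : momentumSpace m)
    (v : TangentSpace 𝓘(ℝ, E3) k) :
    HasDerivAt (fun t => D.toFun (σ t) k v) (D.toFun (familyDeriv σ) k v) 0 := by
  let b := Module.finBasis ℝ F
  have hd := hσ.contDiffAt_localFamily 0 k
  have hb : ∀ i (f : ℝ → F) (f' : F), HasDerivAt f f' 0 →
      HasDerivAt (fun t => b.coord i (f t)) (b.coord i f') 0 := fun i f f' hf =>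
    (LinearMap.toContinuousLinearMap (b.coord i)).hasFDerivAt.comp_hasDerivAt 0 hf
  have h0 : HasDerivAt (fun t => localFamily F σ k (t, (k : E3)))
      (localSection F (familyDeriv σ) k k) 0 := by
    rw [(hσ.localSection_familyDeriv k).self_of_nhds]
    have h1 : DifferentiableAt ℝ (localFamily F σ k) (0, (k : E3)) :=
      hd.differentiableAt (by simp)
    exact (DifferentiableAt.comp (g := localFamily F σ k) (f := fun t : ℝ => (t, (k : E3))) 0
      h1 (by fun_prop)).hasDerivAt
  have h1 := hasDerivAt_fderiv_right hd v
  rw [← (hσ.localSection_familyDeriv k).fderiv_eq] at h1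
  rw [D.toFun_eq_sum hσ.isSmoothSection_familyDeriv k v b]
  -- The frame and its covariant derivative do not depend on `t`; only the coefficients and their
  -- derivatives along `v` remain to be differentiated.
  have h2 : (fun t => D.toFun (σ t) k v) = fun t => ∑ i,
      (b.coord i (localFamily F σ k (t, (k : E3)))
          • D.toFun ((trivializationAt F V k).localFrame b i) k v
        + b.coord i (fderiv ℝ (fun y => localFamily F σ k (t, y)) k v)
          • (trivializationAt F V k).localFrame b i k) :=
    funext fun t => D.toFun_eq_sum (hσ.isSmoothSection t) k v b
  rw [h2]
  refine HasDerivAt.fun_sum fun i _ => ?_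
  exact ((hb i _ _ h0).smul_const _).add ((hb i _ _ h1).smul_const _)

end Connection

/-! ### The generators of rotations as vector fields -/

lemma mfderiv_coe (k : momentumSpace m) :
    mfderiv 𝓘(ℝ, E3) 𝓘(ℝ, E3) ((↑) : momentumSpace m → E3) k = ContinuousLinearMap.id ℝ E3 := by
  have h : MDifferentiableAt 𝓘(ℝ, E3) 𝓘(ℝ, E3) ((↑) : momentumSpace m → E3) k :=
    (contMDiff_subtype_val (n := ∞)).contMDiffAt.mdifferentiableAt (by simp)
  rw [h.mfderiv]
  simp only [modelWithCornersSelf_coe, Set.range_id, fderivWithin_univ]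
  have h' : writtenInExtChartAt 𝓘(ℝ, E3) 𝓘(ℝ, E3) k ((↑) : momentumSpace m → E3)
      =ᶠ[nhds (k : E3)] id := by
    filter_upwards [(momentumSpace m).isOpen.mem_nhds k.2] with y hy
    exact congrArg Subtype.val (extChartAt_symm_coe k ⟨y, hy⟩)
  exact h'.fderiv_eq.trans fderiv_id

/-- The linear vector field `y ↦ v × y` on all of `ℝ³`. -/
noncomputable def ambientCrossField (v : E3) (y : E3) : TangentSpace 𝓘(ℝ, E3) y := crossCLM v y

lemma contMDiff_ambientCrossField (v : E3) :
    ContMDiff 𝓘(ℝ, E3) (𝓘(ℝ, E3).prod 𝓘(ℝ, E3)) ∞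
      (fun y => (⟨y, ambientCrossField v y⟩ : TangentBundle 𝓘(ℝ, E3) E3)) := fun _ =>
  contMDiffAt_vectorSpace_iff_contDiffAt.2 (crossCLM v).contDiff.contDiffAt

lemma isInvertible_mfderiv_coe (k : momentumSpace m) :
    (mfderiv 𝓘(ℝ, E3) 𝓘(ℝ, E3) ((↑) : momentumSpace m → E3) k).IsInvertible := by
  rw [mfderiv_coe]
  exact ⟨ContinuousLinearEquiv.refl ℝ E3, rfl⟩

lemma mpullback_coe_apply (X : ∀ y : E3, TangentSpace 𝓘(ℝ, E3) y) (k : momentumSpace m) :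
    VectorField.mpullback 𝓘(ℝ, E3) 𝓘(ℝ, E3) ((↑) : momentumSpace m → E3) X k = X k := by
  rw [VectorField.mpullback_apply, mfderiv_coe]
  exact DFunLike.congr_fun (ContinuousLinearMap.inverse_id (R := ℝ) (M := E3)) _

lemma mpullback_ambientCrossField (v : E3) :
    VectorField.mpullback 𝓘(ℝ, E3) 𝓘(ℝ, E3) ((↑) : momentumSpace m → E3)
      (ambientCrossField v) = crossField v :=
  funext fun k => mpullback_coe_apply (ambientCrossField v) k

lemma isSmoothField_crossField (v : E3) : IsSmoothField (crossField (m := m) v) := by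
  have h := (contMDiff_ambientCrossField v).mpullback_vectorField (n := ∞)
    (contMDiff_subtype_val (U := momentumSpace m)) isInvertible_mfderiv_coe (by rfl)
  rwa [mpullback_ambientCrossField] at h

/-- The Lie bracket of two infinitesimal rotations. -/
lemma mlieBracket_crossField (v w : E3) :
    VectorField.mlieBracket 𝓘(ℝ, E3) (crossField (m := m) v) (crossField w)
      = fun k => -crossField (cross v w) k := by
  funext k
  have hs : ∀ u : E3, MDifferentiableAt 𝓘(ℝ, E3) (𝓘(ℝ, E3).prod 𝓘(ℝ, E3))
      (fun y => (⟨y, ambientCrossField u y⟩ : TangentBundle 𝓘(ℝ, E3) E3)) (k : E3) := fun u =>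
    (contMDiff_ambientCrossField u).contMDiffAt.mdifferentiableAt (by simp)
  have hn : minSmoothness ℝ 2 ≤ (∞ : WithTop ℕ∞) := by
    rw [minSmoothness_of_isRCLikeNormedField]
    exact WithTop.coe_le_coe.2 (le_top : (2 : ℕ∞) ≤ ⊤)
  -- Lie brackets commute with pullback along the inclusion, which reduces the claim to linear
  -- fields on `ℝ³`.
  rw [← mpullback_ambientCrossField, ← mpullback_ambientCrossField,
    ← VectorField.mpullback_mlieBracket (n := ∞) (hs v) (hs w)
      contMDiff_subtype_val.contMDiffAt hn, mpullback_coe_apply,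
    ← VectorField.mlieBracketWithin_univ, VectorField.mlieBracketWithin_eq_lieBracketWithin]
  have h : VectorField.lieBracketWithin ℝ (crossCLM v) (crossCLM w) Set.univ (k : E3)
      = -cross (cross v w) k := by
    rw [VectorField.lieBracketWithin_univ, VectorField.lieBracket, (crossCLM v).fderiv,
      (crossCLM w).fderiv]
    exact cross_leibniz v w k
  exact h

/-! ### Infinitesimal rotations of wave functions -/

lemma contDiff_act {P : Type*} [NormedAddCommGroup P] [NormedSpace ℝ P] {γ : P → SO3}
    (hγ : ∀ i j, ContDiff ℝ ∞ fun x => (γ x).1 i j) {v : P → E3} (hv : ContDiff ℝ ∞ v) :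
    ContDiff ℝ ∞ fun x => (γ x).act (v x) := by
  rw [contDiff_euclidean]
  intro i
  have hv' := contDiff_euclidean.1 hv
  simp only [SO3.act, Matrix.mulVec, dotProduct]
  exact ContDiff.sum fun j _ => (hγ i j).mul (hv' j)

lemma contDiff_poincareCoords {P : Type*} [NormedAddCommGroup P] [NormedSpace ℝ P] {γ : P → SO3}
    (hγ : ∀ i j, ContDiff ℝ ∞ fun x => (γ x).1 i j) :
    ContDiff ℝ ∞ fun x => poincareCoords (γ x).toPoincare := by
  refine ContDiff.prodMk ?_ ?_
  · rw [contDiff_clm_apply_iff]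
    exact fun p => ContDiff.prodMk contDiff_const (contDiff_act hγ contDiff_const)
  · exact ContDiff.prodMk contDiff_const (contDiff_act hγ contDiff_const)

namespace ParticleBundle

variable (E : ParticleBundle F V)

/-- Rotating a smooth family of wave functions by a smooth family of rotations. -/
lemma isSmoothFamily_actSection {P : Type*} [NormedAddCommGroup P] [NormedSpace ℝ P]
    {γ : P → SO3} (hγ : ∀ i j, ContDiff ℝ ∞ fun x => (γ x).1 i j) {σ : P → ∀ k, V k}
    (hσ : IsSmoothFamily F σ) :
    IsSmoothFamily F fun x => E.actSection (γ x).toPoincare (σ x) := by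
  obtain ⟨Φ, hΦ, hs⟩ := E.smooth_act
  have hγ' : ∀ i j, ContDiff ℝ ∞ fun x => ((γ x)⁻¹).1 i j := fun i j => by
    simp only [SO3.coe_inv]
    exact hγ j i
  have h1 : ContMDiff (𝓘(ℝ, P).prod 𝓘(ℝ, E3)) 𝓘(ℝ, E3) ∞
      fun q : P × momentumSpace m => (γ q.1)⁻¹.toPoincare • q.2 := by
    rw [← ContMDiff.subtypeVal_comp_iff]
    have h : ContDiff ℝ ∞ fun q : P × E3 => (γ q.1)⁻¹.act q.2 :=
      contDiff_act (γ := fun q : P × E3 => (γ q.1)⁻¹)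
        (fun i j => (hγ' i j).comp contDiff_fst) contDiff_snd
    exact h.contMDiff.comp (I' := 𝓘(ℝ, P × E3))
      (f := fun q : P × momentumSpace m => (q.1, (q.2 : E3)))
      (contMDiff_fst.prodMk_space (contMDiff_subtype_val.comp contMDiff_snd))
  have h2 : ContMDiff (𝓘(ℝ, P).prod 𝓘(ℝ, E3)) (𝓘(ℝ, E3).prod 𝓘(ℝ, F)) ∞
      fun q : P × momentumSpace m => (⟨(γ q.1)⁻¹.toPoincare • q.2,
        σ q.1 ((γ q.1)⁻¹.toPoincare • q.2)⟩ : TotalSpace F V) :=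
    ContMDiff.comp (I' := 𝓘(ℝ, P).prod 𝓘(ℝ, E3)) hσ (contMDiff_fst.prodMk h1)
  have h3 : ContMDiff (𝓘(ℝ, P).prod 𝓘(ℝ, E3)) 𝓘(ℝ, (Mink →L[ℝ] Mink) × Mink) ∞
      fun q : P × momentumSpace m => poincareCoords (γ q.1).toPoincare :=
    (contDiff_poincareCoords hγ).contMDiff.comp contMDiff_fst
  -- `Φ` is smooth only within the set of group coordinates, so the composition uses that the curve
  -- of rotations stays in it.
  have h4 := hs.comp (contMDiffOn_univ.2 (h3.prodMk h2)) (fun q _ => ⟨⟨_, rfl⟩, Set.mem_univ _⟩)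
  rw [contMDiffOn_univ] at h4
  refine h4.congr fun q => ?_
  simp only [Function.comp_apply]
  rw [hΦ, E.mk_actSection, SO3.toPoincare_inv]

lemma isSmoothSection_actSection (R : SO3) {ψ : ∀ k, V k} (hψ : IsSmoothSection F V ψ) :
    IsSmoothSection F V (E.actSection R.toPoincare ψ) :=
  (E.isSmoothFamily_actSection (P := ℝ) (γ := fun _ => R) (fun _ _ => contDiff_const)
    (isSmoothFamily_const hψ)).isSmoothSection 0

lemma isSmoothFamily_rot (a : Fin 3) {ψ : ∀ k, V k} (hψ : IsSmoothSection F V ψ) :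
    IsSmoothFamily F fun t => E.actSection (rot a t).toPoincare ψ :=
  E.isSmoothFamily_actSection (contDiff_rot a) (isSmoothFamily_const hψ)

/-- The infinitesimal rotation of a wave function about the `a`-th coordinate axis. -/
noncomputable def rotDeriv (a : Fin 3) (ψ : ∀ k, V k) : ∀ k, V k :=
  familyDeriv fun t => E.actSection (rot a t).toPoincare ψ

lemma J_eq_smul_rotDeriv (a : Fin 3) (ψ : ∀ k, V k) : E.J a ψ = Complex.I • E.rotDeriv a ψ := rfl

lemma isSmoothSection_rotDeriv (a : Fin 3) {ψ : ∀ k, V k} (hψ : IsSmoothSection F V ψ) :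
    IsSmoothSection F V (E.rotDeriv a ψ) :=
  (E.isSmoothFamily_rot a hψ).isSmoothSection_familyDeriv

lemma hasDerivAt_rotDeriv (a : Fin 3) {ψ : ∀ k, V k} (hψ : IsSmoothSection F V ψ)
    (k : momentumSpace m) :
    HasDerivAt (fun t => E.actSection (rot a t).toPoincare ψ k) (E.rotDeriv a ψ k) 0 :=
  (E.isSmoothFamily_rot a hψ).hasDerivAt k

lemma rotDeriv_smul (a : Fin 3) (c : ℂ) {ψ : ∀ k, V k} (hψ : IsSmoothSection F V ψ) :
    E.rotDeriv a (c • ψ) = c • E.rotDeriv a ψ := by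
  funext k
  have h := (E.hasDerivAt_rotDeriv a hψ k).const_smul c
  rw [rotDeriv, familyDeriv]
  simp only [actSection_smul, Pi.smul_apply]
  exact h.deriv

lemma rotDeriv_add (a : Fin 3) {ψ χ : ∀ k, V k} (hψ : IsSmoothSection F V ψ)
    (hχ : IsSmoothSection F V χ) :
    E.rotDeriv a (ψ + χ) = E.rotDeriv a ψ + E.rotDeriv a χ := by
  funext k
  have h := (E.hasDerivAt_rotDeriv a hψ k).add (E.hasDerivAt_rotDeriv a hχ k)
  rw [rotDeriv, familyDeriv]
  simp only [actSection_add, Pi.add_apply]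
  exact h.deriv

variable [FiniteDimensional ℂ F]

lemma hasDerivAt_actSection (g : Poincare) {σ : ℝ → ∀ k, V k} (hσ : IsSmoothFamily F σ)
    (k : momentumSpace m) :
    HasDerivAt (fun t => E.actSection g (σ t) k) (E.actSection g (familyDeriv σ) k) 0 := by
  obtain ⟨k, rfl⟩ : ∃ k', k = g • k' := ⟨g⁻¹ • k, by simp⟩
  simp only [actSection_smul_apply]
  have : FiniteDimensional ℝ (V k) := VectorBundle.finiteDimensional ℝ F V k
  exact (LinearMap.toContinuousLinearMap
    ((E.act g k).restrictScalars ℝ)).hasFDerivAt.comp_hasDerivAt 0 (hσ.hasDerivAt k)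

/-- Infinitesimal rotations commute with the derivative with respect to a parameter. -/
lemma hasDerivAt_rotDeriv_family (c : Fin 3) {σ : ℝ → ∀ k, V k} (hσ : IsSmoothFamily F σ)
    (k : momentumSpace m) :
    HasDerivAt (fun s => E.rotDeriv c (σ s) k) (E.rotDeriv c (familyDeriv σ) k) 0 := by
  have h1 : IsSmoothFamily F fun x : ℝ × ℝ => E.actSection (rot c x.2).toPoincare (σ x.1) :=
    E.isSmoothFamily_actSection (γ := fun x : ℝ × ℝ => rot c x.2)
      (fun i j => (contDiff_rot c i j).comp contDiff_snd) (hσ.comp contDiff_fst)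
  -- Mixed partials of the two-parameter family at the fixed point `k`: first in the family
  -- parameter, then in the angle, and conversely.
  have h2 := hasDerivAt_fderiv_right (x := (0 : ℝ)) (h1.contDiff k).contDiffAt 1
  simp only [fderiv_apply_one_eq_deriv] at h2
  have h3 : ∀ t, deriv (fun s => E.actSection (rot c t).toPoincare (σ s) k) 0
      = E.actSection (rot c t).toPoincare (familyDeriv σ) k := fun t =>
    (E.hasDerivAt_actSection _ hσ k).deriv
  simp only [h3] at h2
  exact h2

/-- All axes are handled by one differentiable map `H` on `ℝ³`: the linearity of its differential at
`0` expresses the generator about `w` through those about the coordinate axes. -/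
lemma hasDerivAt_cayley {φ : ∀ k, V k} (hφ : IsSmoothSection F V φ) (k : momentumSpace m)
    (w : E3) :
    HasDerivAt (fun t : ℝ => E.actSection (cayley (Real.tan (t / 2) • w)).toPoincare φ k)
      (∑ c, w c • E.rotDeriv c φ k) 0 := by
  let H : E3 → V k := fun u => E.actSection (cayley u).toPoincare φ k
  have hH : HasFDerivAt H (fderiv ℝ H 0) 0 :=
    (((E.isSmoothFamily_actSection contDiff_cayley (isSmoothFamily_const hφ)).contDiff
      k).differentiable (by simp)).differentiableAt.hasFDerivAt
  have htan : HasDerivAt (fun t : ℝ => Real.tan (t / 2)) (1 / 2) 0 := by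
    have h := (Real.hasDerivAt_tan (x := 0 / 2) (by simp)).comp (0 : ℝ)
      ((hasDerivAt_id (0 : ℝ)).div_const 2)
    simpa [Function.comp_def] using h
  have hw : ∀ w : E3, HasDerivAt (fun t : ℝ => H (Real.tan (t / 2) • w))
      (fderiv ℝ H 0 ((1 / 2 : ℝ) • w)) 0 := fun w => by
    refine HasFDerivAt.comp_hasDerivAt (l := H) (f := fun t : ℝ => Real.tan (t / 2) • w) (0 : ℝ)
      ?_ (htan.smul_const w)
    simpa using hH
  have hc : ∀ c, E.rotDeriv c φ k = fderiv ℝ H 0 ((1 / 2 : ℝ) • e c) := fun c => by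
    refine (E.hasDerivAt_rotDeriv c hφ k).unique ((hw (e c)).congr_of_eventuallyEq ?_)
    have h0 : ∀ᶠ t : ℝ in nhds 0, Real.cos (t / 2) ≠ 0 :=
      ContinuousAt.eventually_ne (by fun_prop) (by simp)
    filter_upwards [h0] with t ht
    rw [rot_eq_cayley c ht]
  have hsum : ∑ c, w c • E.rotDeriv c φ k = fderiv ℝ H 0 ((1 / 2 : ℝ) • w) := by
    conv_rhs => rw [← sum_smul_e w]
    simp only [hc, map_smul, map_sum, Finset.smul_sum]
    exact Finset.sum_congr rfl fun c _ => smul_comm _ _ _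
  rw [hsum]
  exact hw w

/-- Infinitesimal rotations transform as a vector under rotations. -/
lemma actSection_rotDeriv (R : SO3) (b : Fin 3) {ψ : ∀ k, V k} (hψ : IsSmoothSection F V ψ)
    (k : momentumSpace m) :
    E.actSection R.toPoincare (E.rotDeriv b ψ) k
      = ∑ c, (R.act (e b)) c • E.rotDeriv c (E.actSection R.toPoincare ψ) k := by
  -- Both sides are velocities at `0` of one curve, because `R R_b(t) = cayley (tan (t/2) • R e_b)
  -- R` for small `t`.
  refine (E.hasDerivAt_actSection R.toPoincare (E.isSmoothFamily_rot b hψ) k).unique ?_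
  refine (E.hasDerivAt_cayley (E.isSmoothSection_actSection R hψ) k
    (R.act (e b))).congr_of_eventuallyEq ?_
  have h0 : ∀ᶠ t : ℝ in nhds 0, Real.cos (t / 2) ≠ 0 :=
    ContinuousAt.eventually_ne (by fun_prop) (by simp)
  filter_upwards [h0] with t ht
  rw [← SO3.act_smul, ← SO3.conj_cayley, ← rot_eq_cayley b ht, ← actSection_mul,
    ← actSection_mul, ← SO3.toPoincare_mul, ← SO3.toPoincare_mul, inv_mul_cancel_right]

/-- A triple of operators that transforms as a vector under rotations has the commutation
relations of a vector operator with the infinitesimal rotations. -/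
lemma rotDeriv_commutator {A : Fin 3 → (∀ k, V k) → ∀ k, V k} {ψ : ∀ k, V k}
    (hψ : IsSmoothSection F V ψ) (k : momentumSpace m)
    (hrot : ∀ R b, E.actSection (SO3.toPoincare R) (A b ψ) k
      = ∑ c, (R.act (e b)) c • A c (E.actSection R.toPoincare ψ) k)
    (hderiv : ∀ c (σ : ℝ → ∀ k, V k), IsSmoothFamily F σ →
      HasDerivAt (fun t => A c (σ t) k) (A c (familyDeriv σ) k) 0) (a b : Fin 3) :
    E.rotDeriv a (A b ψ) k - A b (E.rotDeriv a ψ) k = ∑ c, eps a b c • A c ψ k := by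
  have h1 : HasDerivAt (fun t => E.actSection (rot a t).toPoincare (A b ψ) k)
      (∑ c, ((e b) c • A c (E.rotDeriv a ψ) k + eps a b c • A c ψ k)) 0 := by
    simp only [hrot]
    refine HasDerivAt.fun_sum fun c _ => ?_
    -- Product rule at `t = 0`, where `R_a(0) = 1`: one term differentiates the rotation matrix, the
    -- other the rotated section.
    have h := (hasDerivAt_rot_act a b c).smul (hderiv c _ (E.isSmoothFamily_rot a hψ))
    simp only [rot_zero, SO3.one_act, SO3.toPoincare_one, actSection_one] at h
    exact h
  have h2 : ∑ c, (e b) c • A c (E.rotDeriv a ψ) k = A b (E.rotDeriv a ψ) k := by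
    rw [Finset.sum_eq_single b]
    · simp [e]
    · intro c _ hc
      simp [e, hc]
    · simp
  have h3 : E.rotDeriv a (A b ψ) k = _ := h1.deriv
  rw [h3, Finset.sum_add_distrib, h2, add_sub_cancel_left]

end ParticleBundle

/-! ### Transverse vector fields -/

lemma IsSmoothField.continuous {X : ∀ k : momentumSpace m, TangentSpace 𝓘(ℝ, E3) k}
    (hX : IsSmoothField X) : Continuous (X : momentumSpace m → E3) := by
  have h1 : ContMDiff 𝓘(ℝ, E3).tangent 𝓘(ℝ, E3).tangent 0
      (tangentMap 𝓘(ℝ, E3) 𝓘(ℝ, E3) ((↑) : momentumSpace m → E3)) :=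
    (contMDiff_subtype_val (n := 1)).contMDiff_tangentMap (by rfl)
  have h2 : Continuous fun k : momentumSpace m =>
      tangentMap 𝓘(ℝ, E3) 𝓘(ℝ, E3) ((↑) : momentumSpace m → E3) ⟨k, X k⟩ :=
    h1.continuous.comp (ContMDiff.continuous hX)
  have h3 : Continuous fun p : TangentBundle 𝓘(ℝ, E3) E3 => (p.2 : E3) :=
    (contMDiff_snd_tangentBundle_modelSpace (n := 0) E3 𝓘(ℝ, E3)).continuous
  refine (h3.comp h2).congr fun k => ?_
  show mfderiv 𝓘(ℝ, E3) 𝓘(ℝ, E3) ((↑) : momentumSpace m → E3) k (X k) = X k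
  rw [mfderiv_coe]
  rfl

/-- With `v = X(0)`, transversality at `t v` gives `X(t v) ⬝ v = 0` for small `t > 0`; letting `t`
tend to `0` yields `|v|² = 0`. -/
lemma IsTransverse.eq_zero {X : ∀ k : momentumSpace m, TangentSpace 𝓘(ℝ, E3) k}
    (hX : IsSmoothField X) (ht : IsTransverse X) {k : momentumSpace m} (hk : (k : E3) = 0) :
    (X k : E3) = 0 := by
  let Y : momentumSpace m → E3 := X
  have hY : Continuous Y := hX.continuous
  set v : E3 := Y k
  -- The inverse chart makes `p` total; only small `t`, where `p t` is the point `t v`, matter.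
  let p : ℝ → momentumSpace m := fun t => (extChartAt 𝓘(ℝ, E3) k).symm (t • v)
  have hp0 : p 0 = k := by
    simp only [p]
    rw [zero_smul, ← hk, extChartAt_symm_coe]
  have hc : ContinuousAt (fun t => Y (p t)) 0 := by
    have h1 : ContinuousAt (extChartAt 𝓘(ℝ, E3) k).symm ((0 : ℝ) • v) := by
      rw [zero_smul, ← hk]
      exact (contMDiffAt_extChartAt_symm_coe k).continuousAt
    exact hY.continuousAt.comp (ContinuousAt.comp (f := fun t : ℝ => t • v) h1 (by fun_prop))
  have hlim : Filter.Tendsto (fun t => (inner ℝ (Y (p t)) v : ℝ))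
      (nhdsWithin 0 (Set.Ioi 0)) (nhds (inner ℝ v v)) := by
    have h := (hc.inner (𝕜 := ℝ) (continuousAt_const (y := v))).tendsto
    simp only [hp0] at h
    exact h.mono_left nhdsWithin_le_nhds
  have hz : ∀ᶠ t in nhdsWithin (0 : ℝ) (Set.Ioi 0), (inner ℝ (Y (p t)) v : ℝ) = 0 := by
    have hmem : ∀ᶠ t : ℝ in nhds 0, t • v ∈ momentumSpace m := by
      have h1 : ContinuousAt (fun t : ℝ => t • v) 0 := by fun_prop
      refine h1.eventually ((momentumSpace m).isOpen.mem_nhds ?_)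
      simp only [zero_smul, ← hk]
      exact k.2
    filter_upwards [hmem.filter_mono nhdsWithin_le_nhds, self_mem_nhdsWithin] with t h1 h2
    have h3 : p t = ⟨t • v, h1⟩ := extChartAt_symm_coe k ⟨t • v, h1⟩
    have h4 : (inner ℝ (Y ⟨t • v, h1⟩) (t • v) : ℝ) = 0 := ht ⟨t • v, h1⟩
    rw [h3]
    rw [inner_smul_right] at h4
    exact (mul_eq_zero.1 h4).resolve_left (ne_of_gt h2)
  have h := tendsto_nhds_unique hlim (tendsto_const_nhds.congr' (hz.mono fun _ h => h.symm))
  exact inner_self_eq_zero.1 h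

/-- A smooth transverse field is pointwise an infinitesimal rotation. -/
lemma IsTransverse.exists_eq_crossField {X : ∀ k : momentumSpace m, TangentSpace 𝓘(ℝ, E3) k}
    (hX : IsSmoothField X) (ht : IsTransverse X) (k : momentumSpace m) :
    ∃ w, X k = crossField w k := by
  by_cases hk : (k : E3) = 0
  · exact ⟨0, (ht.eq_zero hX hk).trans (by simp [cross] : (0 : E3) = cross 0 k)⟩
  · exact exists_cross_eq hk (ht k)

lemma isTransverse_crossField (v : E3) : IsTransverse (crossField (m := m) v) := by
  intro k
  simp only [crossField, cross, PiLp.inner_apply, Fin.sum_univ_three, cross_apply]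
  simp
  ring

lemma crossField_eq_sum (v : E3) (k : momentumSpace m) :
    crossField v k = ∑ c, v c • crossField (e c) k :=
  cross_eq_sum v k

/-! ### Commutation relations -/

namespace Connection

variable (D : Connection F V)

lemma along_smul (X : ∀ k : momentumSpace m, TangentSpace 𝓘(ℝ, E3) k) (c : ℂ) {ψ : ∀ k, V k}
    (hψ : IsSmoothSection F V ψ) : D.along X (c • ψ) = c • D.along X ψ :=
  funext fun k => D.map_smul c ψ hψ k (X k)

lemma along_add (X : ∀ k : momentumSpace m, TangentSpace 𝓘(ℝ, E3) k) {ψ χ : ∀ k, V k}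
    (hψ : IsSmoothSection F V ψ) (hχ : IsSmoothSection F V χ) :
    D.along X (ψ + χ) = D.along X ψ + D.along X χ := by
  funext k
  have h := D.isCovariantDerivativeOnUniv.add (hψ.mdifferentiableAt k) (hχ.mdifferentiableAt k)
  exact DFunLike.congr_fun h (X k)

lemma along_crossField_eq_sum (v : E3) (ψ : ∀ k, V k) (k : momentumSpace m) :
    D.along (crossField v) ψ k = ∑ c, v c • D.along (crossField (e c)) ψ k := by
  simp only [along, crossField_eq_sum v, map_sum, _root_.map_smul]

/-- Covariant derivatives along infinitesimal rotations. -/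
lemma along_crossField_commutator (a b : Fin 3) (ψ : ∀ k, V k) (k : momentumSpace m) :
    D.along (crossField (e a)) (D.along (crossField (e b)) ψ) k
        - D.along (crossField (e b)) (D.along (crossField (e a)) ψ) k
      = D.curvature (crossField (e a)) (crossField (e b)) ψ k
        - ∑ c, eps a b c • D.along (crossField (e c)) ψ k := by
  have h : D.along (VectorField.mlieBracket 𝓘(ℝ, E3) (crossField (e a)) (crossField (e b))) ψ k
      = -∑ c, eps a b c • D.along (crossField (e c)) ψ k := by
    rw [mlieBracket_crossField]
    have h' := D.along_crossField_eq_sum (cross (e a) (e b)) ψ k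
    simp only [eps_eq_cross, ← h']
    simp [along]
  rw [curvature, h]
  abel

lemma L_eq_smul (a : Fin 3) (ψ : ∀ k, V k) :
    D.L a ψ = (-Complex.I) • D.along (crossField (e a)) ψ := by
  funext k
  simp [L]

variable [FiniteDimensional ℂ F]

/-- The connection is `S²`-flat if the curvature vanishes on infinitesimal rotations. -/
lemma isS2Flat_iff : D.IsS2Flat ↔ ∀ (a b : Fin 3) (ψ : ∀ k, V k), IsSmoothSection F V ψ →
    ∀ k, D.curvature (crossField (e a)) (crossField (e b)) ψ k = 0 := by
  refine ⟨fun h a b ψ hψ k => h _ _ (isSmoothField_crossField _) (isSmoothField_crossField _)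
    (isTransverse_crossField _) (isTransverse_crossField _) ψ hψ k,
    fun h X Y hX hY hXt hYt ψ hψ k => ?_⟩
  have key : ∀ Φ : (∀ k : momentumSpace m, TangentSpace 𝓘(ℝ, E3) k) → V k,
      TensorialAt 𝓘(ℝ, E3) E3 Φ k → (∀ c, Φ (crossField (e c)) = 0) →
      ∀ Z, IsSmoothField Z → IsTransverse Z → Φ Z = 0 := by
    intro Φ hΦ h0 Z hZ hZt
    obtain ⟨w, hw⟩ := hZt.exists_eq_crossField hZ k
    -- A tensorial `Φ` depends linearly on the value at `k` alone, so `Z` may be replaced by a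
    -- rotation field agreeing with it at this one point.
    rw [← TensorialAt.mkHom_apply hΦ (hZ.mdifferentiableAt k), hw, crossField_eq_sum, map_sum]
    refine Finset.sum_eq_zero fun c _ => ?_
    rw [_root_.map_smul, TensorialAt.mkHom_apply hΦ ((isSmoothField_crossField (e c)).mdifferentiableAt k),
      h0, smul_zero]
  refine key _ (D.tensorialAt_curvature_left Y hψ k) (fun a => ?_) X hX hXt
  exact key _ (D.tensorialAt_curvature_right (crossField (e a)) hψ k) (fun b => h a b ψ hψ k)
    Y hY hYt

/-- The factor `(-i)² = -1` reverses both signs in the commutator of the covariant derivatives;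
complex linearity of `D` is what lets the inner `-i` pass through. -/
lemma L_commutator (a b : Fin 3) {ψ : ∀ k, V k} (hψ : IsSmoothSection F V ψ)
    (k : momentumSpace m) :
    D.L a (D.L b ψ) k - D.L b (D.L a ψ) k
      = Complex.I • (∑ c, (eps a b c : ℂ) • D.L c ψ k)
        - D.curvature (crossField (e a)) (crossField (e b)) ψ k := by
  have hs : ∀ c, IsSmoothSection F V (D.along (crossField (e c)) ψ) := fun c =>
    D.isSmoothSection_along (isSmoothField_crossField _) hψ
  have h := D.along_crossField_commutator a b ψ k
  have hL : ∀ a b, D.L a (D.L b ψ) k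
      = -D.along (crossField (e a)) (D.along (crossField (e b)) ψ) k := fun a b => by
    rw [L_eq_smul, L_eq_smul, along_smul _ _ _ (hs b)]
    simp [smul_smul]
  have hR : Complex.I • (∑ c, (eps a b c : ℂ) • D.L c ψ k)
      = ∑ c, eps a b c • D.along (crossField (e c)) ψ k := by
    rw [Finset.smul_sum]
    refine Finset.sum_congr rfl fun c _ => ?_
    rw [L_eq_smul, Pi.smul_apply, Complex.coe_smul, smul_comm, smul_smul]
    simp
  have h' := congrArg Neg.neg h
  rw [neg_sub, neg_sub] at h'
  rw [hL, hL, hR, ← h']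
  abel

/-- A rotationally symmetric connection is a vector operator. -/
lemma IsRotationallySymmetric.actSection_along {E : ParticleBundle F V} {D : Connection F V}
    (hD : D.IsRotationallySymmetric E) (R : SO3) (b : Fin 3) {ψ : ∀ k, V k}
    (hψ : IsSmoothSection F V ψ) (k : momentumSpace m) :
    E.actSection R.toPoincare (D.along (crossField (e b)) ψ) k
      = ∑ c, (R.act (e b)) c • D.along (crossField (e c)) (E.actSection R.toPoincare ψ) k := by
  -- The symmetry is applied to the rotated section, so that the inverse rotation on the right-hand
  -- side cancels.
  have h := congrFun (hD R _ (isSmoothField_crossField (e b)) _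
    (E.isSmoothSection_actSection R hψ)) k
  rw [← E.actSection_mul, inv_mul_cancel, E.actSection_one] at h
  rw [← h, ← along_crossField_eq_sum]
  have hX : (fun k : momentumSpace m => (R.act (crossField (e b) (R.toPoincare⁻¹ • k)) :
      TangentSpace 𝓘(ℝ, E3) k)) = crossField (R.act (e b)) := by
    funext k
    have hk : ((R.toPoincare⁻¹ • k : momentumSpace m) : E3) = R⁻¹.act k := by
      rw [← SO3.toPoincare_inv, SO3.coe_toPoincare_smul]
    show R.act (cross (e b) _) = cross (R.act (e b)) k
    rw [hk, SO3.act_cross, SO3.act_inv_act]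
  exact congrArg (fun X => D.along X (E.actSection R.toPoincare ψ) k) hX

/-- The commutators of the spin operators of a rotationally symmetric connection. -/
lemma IsRotationallySymmetric.S_commutator {E : ParticleBundle F V} {D : Connection F V}
    (hD : D.IsRotationallySymmetric E) (a b : Fin 3) {ψ : ∀ k, V k}
    (hψ : IsSmoothSection F V ψ) (k : momentumSpace m) :
    D.S E a (D.S E b ψ) k - D.S E b (D.S E a ψ) k
      = Complex.I • (∑ c, (eps a b c : ℂ) • D.S E c ψ k)
        - D.curvature (crossField (e a)) (crossField (e b)) ψ k := by
  have hs : ∀ c, IsSmoothSection F V (D.along (crossField (e c)) ψ) := fun c =>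
    D.isSmoothSection_along (isSmoothField_crossField _) hψ
  have ht := fun c => E.isSmoothSection_rotDeriv c hψ
  have hN : ∀ c (χ : ∀ k, V k), D.S E c χ
      = Complex.I • (E.rotDeriv c χ + D.along (crossField (e c)) χ) := fun c χ => by
    funext k
    simp only [S, E.J_eq_smul_rotDeriv, D.L_eq_smul, Pi.smul_apply, Pi.add_apply]
    module
  have hSS : ∀ a b, D.S E a (D.S E b ψ) k
      = -(E.rotDeriv a (E.rotDeriv b ψ) k + E.rotDeriv a (D.along (crossField (e b)) ψ) k
        + D.along (crossField (e a)) (E.rotDeriv b ψ) k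
        + D.along (crossField (e a)) (D.along (crossField (e b)) ψ) k) := fun a b => by
    have hadd : IsSmoothSection F V (E.rotDeriv b ψ + D.along (crossField (e b)) ψ) :=
      ContMDiff.add_section (ht b) (hs b)
    rw [hN b, hN a, E.rotDeriv_smul a _ hadd, D.along_smul _ _ hadd,
      E.rotDeriv_add a (ht b) (hs b), D.along_add _ (ht b) (hs b), ← smul_add, smul_smul,
      Complex.I_mul_I, Pi.smul_apply, neg_one_smul]
    simp only [Pi.add_apply]
    abel
  have hTT := E.rotDeriv_commutator (A := E.rotDeriv) hψ k
    (fun R b => E.actSection_rotDeriv R b hψ k)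
    (fun c σ hσ => E.hasDerivAt_rotDeriv_family c hσ k) a b
  have hTD := E.rotDeriv_commutator (A := fun c => D.along (crossField (e c))) hψ k
    (fun R b => hD.actSection_along R b hψ k) (fun c σ hσ => D.hasDerivAt_toFun hσ k _)
  have hTD1 := hTD a b
  have hTD2 := hTD b a
  have hDD := D.along_crossField_commutator a b ψ k
  have hR : Complex.I • (∑ c, (eps a b c : ℂ) • D.S E c ψ k)
      = -(∑ c, eps a b c • E.rotDeriv c ψ k
        + ∑ c, eps a b c • D.along (crossField (e c)) ψ k) := by
    rw [Finset.smul_sum, ← Finset.sum_add_distrib, ← Finset.sum_neg_distrib]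
    refine Finset.sum_congr rfl fun c _ => ?_
    rw [hN, Pi.smul_apply, Complex.coe_smul, smul_comm, smul_smul, Complex.I_mul_I]
    simp [smul_add]
    abel
  simp only [eps_swap a b, neg_smul, Finset.sum_neg_distrib] at hTD2
  rw [hSS, hSS, hR, ← hTT]
  -- Replacing `ε_abc D_c` by `[T_a, D_b]` everywhere leaves an identity between compositions in an
  -- additive group.
  rw [← hTD1] at hTD2 hDD ⊢
  rw [sub_eq_iff_eq_add] at hDD hTD2
  rw [hDD, hTD2]
  abel

/-- Isolates what `L` and `S` share: the curvature on rotation fields is the exact defect in the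
relations. -/
lemma angularMomentumRelations_iff {A : Fin 3 → (∀ k, V k) → ∀ k, V k}
    (hA : ∀ (a b : Fin 3) (ψ : ∀ k, V k), IsSmoothSection F V ψ → ∀ k : momentumSpace m,
      A a (A b ψ) k - A b (A a ψ) k = Complex.I • (∑ c, (eps a b c : ℂ) • A c ψ k)
        - D.curvature (crossField (e a)) (crossField (e b)) ψ k) :
    AngularMomentumRelations F A ↔ D.IsS2Flat := by
  rw [D.isS2Flat_iff]
  refine forall_congr' fun a => forall_congr' fun b => forall_congr' fun ψ =>
    forall_congr' fun hψ => forall_congr' fun k => ?_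
  rw [hA a b ψ hψ k, sub_eq_self]

end Connection

end Particle

theorem theorem3 {m : ℝ} (hm : 0 ≤ m)
    {F : Type*} [NormedAddCommGroup F] [NormedSpace ℂ F] [FiniteDimensional ℂ F]
    {V : momentumSpace m → Type*} [∀ k, NormedAddCommGroup (V k)]
    [∀ k, InnerProductSpace ℂ (V k)] [TopologicalSpace (TotalSpace F V)] [FiberBundle F V]
    [VectorBundle ℂ F V] [VectorBundle ℝ F V] [ContMDiffVectorBundle ∞ F V 𝓘(ℝ, E3)]
    (E : ParticleBundle F V) (D : Connection F V) :
    (∀ (a b : Fin 3) (ψ : ∀ k, V k), IsSmoothSection F V ψ → ∀ k : momentumSpace m,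
      D.L a (D.L b ψ) k - D.L b (D.L a ψ) k
        = Complex.I • (∑ c, (eps a b c : ℂ) • D.L c ψ k)
          - D.curvature (crossField (e a)) (crossField (e b)) ψ k) ∧
    (AngularMomentumRelations F D.L ↔ D.IsS2Flat) ∧
    (D.IsRotationallySymmetric E →
      ((AngularMomentumRelations F (D.S E) ∧ AngularMomentumRelations F D.L) ↔ D.IsS2Flat) ∧
      (AngularMomentumRelations F (D.S E) ↔ D.IsS2Flat)) := by
  have hL := D.angularMomentumRelations_iff fun a b ψ hψ k => D.L_commutator a b hψ k
  refine ⟨fun a b ψ hψ k => D.L_commutator a b hψ k, hL, fun hD => ?_⟩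
  have hS := D.angularMomentumRelations_iff fun a b ψ hψ k => hD.S_commutator a b hψ k
  exact ⟨by rw [hS, hL, and_self], hS⟩
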